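/- **Conventions.** An *ordered blueprint* $B=(B^\bullet,B^+,\le)$ is a commutative semiring $B^+$ with a partial order compatible with addition and multiplication, together with a multiplicative subset $B^\bullet\ni 0,1$ that generates $B^+$ as a semiring; a morphism is an order-preserving semiring homomorphism $B^+\to C^+$ that maps $B^\bullet$ to $C^\bullet$. Write $B^\times$ for the group of invertible elements of $B^\bullet$. $B$ is *pasteurized* if for every $a\in B^\bullet$ there is a unique $b\in B^\bullet$ with $0\le a+b$; then $\epsilon$ denotes the $b$ belonging to $a=1$. A *pasture* is a pasteurized ordered blueprint $F$ with $0\neq 1$ and $F^\bullet=F^\times\cup\{0\}$ whose order, viewed as a preorder on the formal sums $\mathbb N[F^\times]$, is generated by relations $0\le\sum a_i$. Pastures form a full subcategory of the category of ordered blueprints. Its terminal object is the Krasner hyperfield $\mathbb K=(\{0,1\},\mathbb N,\le)$, whose order is generated by $0\le n$ for $n\ne1$; let $t_F:F\to\mathbb K$ be the unique morphism. The *pasteurization* $B^\pm$ of $B$ is the quotient of $B\otimes_{\mathbb F_1}\mathbb F_1^\pm$ by all relations $a\equiv a'$ such that $0\le a+b$ and $0\le a'+b$ for some $b$; here $\mathbb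 F_1=(\{0,1\},\mathbb N,=)$ and $\mathbb F_1^\pm=\{0,1,\epsilon\}/\!/\langle 0\le 1+\epsilon\rangle$ with $\epsilon^2=1$. Let $E$ be a finite totally ordered set and $r\ge0$ an integer. For a pasture $F$, a *Grassmann–Plücker function* of rank $r$ on $E$ is a map $\Delta:\binom Er\to F^\bullet$ with $\Delta(I)\in F^\times$ for some $I$ and $$0\le\sum_{k=0}^{r}\epsilon^k\,\Delta(I-\{i_k\})\,\Delta(J\cup\{i_k\})$$ for all $(r+1)$-subsets $I=\{i_0<\dots<i_r\}$ and $(r-1)$-subsets $J$ of $E$, where $\Delta(J\cup\{i_k\})=0$ if $i_k\in J$. A (strong) *$F$-matroid* of rank $r$ on $E$ is a class $N=[\Delta]$ of such functions up to multiplication by elements of $F^\times$; its *push-forward* along $g:F\to F'$ is $g_*N=[g\circ\Delta]$. A *matroid* is a $\mathbb K$-matroid, and $t_{F,*}N$ is the *underlying matroid* of $N$. The *matroid space* is the ordered blue scheme $$\mathrm{Mat}(r,E)=\mathrm{Proj}\Big(\mathbb F_1^\pm\big[x_I\,\big|\,I\in\tbinom Er\big]/\!/\mathcal Pl(r,E)\Big),$$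 where $\mathcal Pl(r,E)$ consists of the Plücker relations above with $\Delta(I)$ replaced by $x_I$. $\mathrm{Spec}$ and $\mathrm{Proj}$ are formed with prime $m$-ideals, with the topology generated by principal opens, and with the sheaf of functions that are locally represented by fractions; morphisms are continuous maps with a local morphism of sheaves of ordered blueprints. For an $F$-matroid $N=[\Delta]$ let $\chi_N:\mathrm{Spec}\,F\to\mathrm{Mat}(r,E)$ be the morphism with homogeneous coordinates $x_I\mapsto\Delta(I)$, the *characteristic morphism* of $N$. Let $M$ be a matroid of rank $r$ on $E$. Let $x_M$ be the image point of $\chi_M:\mathrm{Spec}\,\mathbb K\to\mathrm{Mat}(r,E)$, let $k(x_M)$ be its residue field, i.e. the quotient of the stalk at $x_M$ by the relations $a\equiv0$ for all non-units $a$, let $k_M=k(x_M)^\pm$ be the *universal pasture* of $M$, and let $\iota_M:\mathrm{Spec}\,k_M\to\mathrm{Spec}\,k(x_M)\to\mathrm{Mat}(r,E)$ be the canonical morphism. For a pasture $F$, the *realization space* of $M$ over $F$ is $$\mathcal X_M(F)=\{\chi:\mathrm{Spec}\,F\to\mathrm{Mat}(r,E)\mid \chi\circ t_F^*=\chi_M\}.$$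 **Theorem.** Let $M$ be a matroid of rank $r$ on $E$ and $F$ a pasture. Then the map $$\mathrm{Hom}(k_M,F)\longrightarrow\mathcal X_M(F),\qquad f\longmapsto\iota_M\circ f^*$$ is (well defined and) a bijection, and it is functorial in $F$: for a morphism $g:F\to F'$ of pastures, $\chi\mapsto\chi\circ g^*$ maps $\mathcal X_M(F)$ to $\mathcal X_M(F')$, and $\iota_M\circ(g\circ f)^*=(\iota_M\circ f^*)\circ g^*$ for all $f:k_M\to F$. Moreover, $\mathcal X_M(F)$ is the set of strong $F$-matroids with underlying matroid $M$: the map $N\mapsto\chi_N$ is a bijection from the set of $F$-matroids $N$ of rank $r$ on $E$ with $t_{F,*}N=M$ to $\mathcal X_M(F)$. This identification is functorial in $F$: for a morphism $g:F\to F'$ of pastures and such an $N$, the $F'$-matroid $g_*N$ has underlying matroid $M$, and $\chi_{g_*N}=\chi_N\circ g^*$. -/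

import Mathlib

open scoped TensorProduct

universe u v w

set_option linter.unusedVariables false

noncomputable section

namespace OB

/-! ### Ordered blueprints -/

/-- An ordered blueprint `(B^•, B^+, ≤)`: an ordered (commutative) semiring `plus` with a
multiplicative subset `mon` that contains `0` and `1` and generates `plus` as a semiring. -/
structure OBlpr where
  plus : Type u
  [semiring : CommSemiring plus]
  [order : PartialOrder plus]
  add_le : ∀ {x y z t : plus}, x ≤ y → z ≤ t → x + z ≤ y + t
  mul_le : ∀ {x y z t : plus}, x ≤ y → z ≤ t → x * z ≤ y * t
  mon : Submonoid plus
  zero_mem : 0 ∈ mon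
  generates : Subsemiring.closure (mon : Set plus) = ⊤

attribute [instance] OBlpr.semiring OBlpr.order

/-- Morphisms of ordered blueprints. -/
@[ext]
structure Hom (B : OBlpr.{u}) (C : OBlpr.{v}) where
  toRingHom : B.plus →+* C.plus
  mono : ∀ {x y : B.plus}, x ≤ y → toRingHom x ≤ toRingHom y
  map_mon : ∀ {a : B.plus}, a ∈ B.mon → toRingHom a ∈ C.mon

/-- Composition of morphisms, first `f`, then `g`. -/
def Hom.comp {B : OBlpr.{u}} {C : OBlpr.{v}} {D : OBlpr.{w}} (f : Hom B C) (g : Hom C D) :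
    Hom B D where
  toRingHom := g.toRingHom.comp f.toRingHom
  mono h := g.mono (f.mono h)
  map_mon h := g.map_mon (f.map_mon h)

/-- `a` is an element of the unit group `B^×`. -/
def OBlpr.IsUnitElt (B : OBlpr.{u}) (a : B.plus) : Prop :=
  a ∈ B.mon ∧ ∃ b ∈ B.mon, a * b = 1

/-- The unit group `B^×` as a submonoid of `B^+`. -/
def OBlpr.unitGroup (B : OBlpr.{u}) : Submonoid B.plus where
  carrier := {a | B.IsUnitElt a}
  one_mem' := ⟨B.mon.one_mem, 1, B.mon.one_mem, one_mul 1⟩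
  mul_mem' := by
    rintro a b ⟨ha, a', ha', h⟩ ⟨hb, b', hb', h'⟩
    refine ⟨B.mon.mul_mem ha hb, a' * b', B.mon.mul_mem ha' hb', ?_⟩
    rw [mul_mul_mul_comm, h, h', one_mul]

theorem IsUnitElt.map {B : OBlpr.{u}} {C : OBlpr.{v}} (f : Hom B C) {a : B.plus}
    (h : B.IsUnitElt a) : C.IsUnitElt (f.toRingHom a) := by
  obtain ⟨ha, b, hb, hab⟩ := h
  exact ⟨f.map_mon ha, _, f.map_mon hb, by rw [← map_mul, hab, map_one]⟩

/-! ### Presentations and quotients by relations -/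

/-- The smallest preorder on the semiring `R` that contains the relations `S` and is closed under
addition and multiplication. -/
inductive GenLE {R : Type u} [CommSemiring R] (S : R → R → Prop) : R → R → Prop
  | of {x y : R} : S x y → GenLE S x y
  | refl (x : R) : GenLE S x x
  | trans {x y z : R} : GenLE S x y → GenLE S y z → GenLE S x z
  | add {x y z t : R} : GenLE S x y → GenLE S z t → GenLE S (x + z) (y + t)
  | mul {x y z t : R} : GenLE S x y → GenLE S z t → GenLE S (x * z) (y * t)

section Presentation

variable {R : Type u} [CommSemiring R] (S : R → R → Prop)

/-- The congruence `x ≤ y` and `y ≤ x`. -/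
def genCon : RingCon R where
  r x y := GenLE S x y ∧ GenLE S y x
  iseqv :=
    { refl := fun x => ⟨.refl x, .refl x⟩
      symm := fun h => ⟨h.2, h.1⟩
      trans := fun h h' => ⟨h.1.trans h'.1, h'.2.trans h.2⟩ }
  add' h h' := ⟨h.1.add h'.1, h.2.add h'.2⟩
  mul' h h' := ⟨h.1.mul h'.1, h.2.mul h'.2⟩

theorem genCon_mk_eq {x y : R} :
    (genCon S).mk' x = (genCon S).mk' y ↔ GenLE S x y ∧ GenLE S y x :=
  (genCon S).eq

instance genOrder : PartialOrder (genCon S).Quotient where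
  le := Quotient.lift₂ (fun x y => GenLE S x y) (fun _ _ _ _ h h' => propext
    ⟨fun k => h.2.trans (k.trans h'.1), fun k => h.1.trans (k.trans h'.2)⟩)
  le_refl := by rintro ⟨x⟩; exact GenLE.refl x
  le_trans := by rintro ⟨x⟩ ⟨y⟩ ⟨z⟩ h h'; exact GenLE.trans h h'
  le_antisymm := by rintro ⟨x⟩ ⟨y⟩ h h'; exact Quotient.sound ⟨h, h'⟩

theorem mk_le_mk {x y : R} : (genCon S).mk' x ≤ (genCon S).mk' y ↔ GenLE S x y := Iff.rfl

/-- The ordered blueprint presented by a semiring `R`, a multiplicative subset `A` with zero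
generating `R`, and relations `x ≤ y` for `S x y`: its semiring is the quotient of `R`
by the congruence associated with the preorder generated by `S`. -/
def pres (A : Submonoid R) (h0 : 0 ∈ A) (hA : Subsemiring.closure (A : Set R) = ⊤) :
    OBlpr.{u} where
  plus := (genCon S).Quotient
  add_le := by rintro ⟨x⟩ ⟨y⟩ ⟨z⟩ ⟨t⟩ h h'; exact GenLE.add h h'
  mul_le := by rintro ⟨x⟩ ⟨y⟩ ⟨z⟩ ⟨t⟩ h h'; exact GenLE.mul h h'
  mon := A.map (genCon S).mk'
  zero_mem := ⟨0, h0, map_zero _⟩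
  generates := by
    have := RingHom.map_closureS (genCon S).mk' (A : Set R)
    rw [hA] at this
    rw [Submonoid.coe_map, ← this, ← RingHom.rangeS_eq_map]
    exact RingHom.rangeS_top_of_surjective _ (RingCon.mk'_surjective _)

variable {S} {A : Submonoid R} {h0 : 0 ∈ A} {hA : Subsemiring.closure (A : Set R) = ⊤}

theorem GenLE.map {D : OBlpr.{v}} (f : R →+* D.plus) (hf : ∀ x y, S x y → f x ≤ f y) {x y : R}
    (h : GenLE S x y) : f x ≤ f y := by
  induction h with
  | of h => exact hf _ _ h
  | refl x => exact le_rfl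
  | trans _ _ h h' => exact h.trans h'
  | add _ _ h h' => rw [map_add, map_add]; exact D.add_le h h'
  | mul _ _ h h' => rw [map_mul, map_mul]; exact D.mul_le h h'

/-- The canonical map of `R` into a presented blueprint. -/
def pres.mk (S : R → R → Prop) (A : Submonoid R) (h0 : 0 ∈ A)
    (hA : Subsemiring.closure (A : Set R) = ⊤) : R →+* (pres S A h0 hA).plus :=
  (genCon S).mk'

/-- Morphisms out of a presented blueprint. -/
def pres.lift {D : OBlpr.{v}} (f : R →+* D.plus) (hf : ∀ x y, S x y → f x ≤ f y)
    (hm : ∀ a ∈ A, f a ∈ D.mon) : Hom (pres S A h0 hA) D where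
  toRingHom := (genCon S).lift f (fun _ _ h =>
    le_antisymm (GenLE.map f hf h.1) (GenLE.map f hf h.2))
  mono := by rintro ⟨x⟩ ⟨y⟩ h; exact GenLE.map f hf h
  map_mon := by rintro _ ⟨a, ha, rfl⟩; exact hm a ha

end Presentation

/-- The quotient `B // ⟨x ≤ y | S x y⟩`. -/
def OBlpr.quot (B : OBlpr.{u}) (S : B.plus → B.plus → Prop) : OBlpr.{u} :=
  pres (fun x y => x ≤ y ∨ S x y) B.mon B.zero_mem B.generates

/-- The quotient morphism. -/
def OBlpr.toQuot (B : OBlpr.{u}) (S : B.plus → B.plus → Prop) : Hom B (B.quot S) where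
  toRingHom := (genCon (fun x y => x ≤ y ∨ S x y)).mk'
  mono h := GenLE.of (Or.inl h)
  map_mon h := ⟨_, h, rfl⟩

/-! ### Blueprints generated by a multiplicative set in an ordered semiring -/

theorem closure_coe_preimage {R : Type u} [CommSemiring R] (A : Set R) :
    Subsemiring.closure (((↑) : Subsemiring.closure A → R) ⁻¹' A) = ⊤ := by
  rw [eq_top_iff]
  rintro ⟨x, hx⟩ _
  induction hx using Subsemiring.closure_induction with
  | mem x hx => exact Subsemiring.subset_closure hx
  | zero => exact zero_mem _
  | one => exact one_mem _
  | add x y hx hy h h' => exact add_mem (h trivial) (h' trivial)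
  | mul x y hx hy h h' => exact mul_mem (h trivial) (h' trivial)

section Sub

variable {R : Type u} [CommSemiring R] [PartialOrder R]

/-- The ordered blueprint given by a multiplicative subset `A` with zero of an ordered semiring
`R`: its semiring is the subsemiring generated by `A`, with the restricted order. -/
def ofSubmonoid (hadd : ∀ {x y z t : R}, x ≤ y → z ≤ t → x + z ≤ y + t)
    (hmul : ∀ {x y z t : R}, x ≤ y → z ≤ t → x * z ≤ y * t) (A : Submonoid R) (h0 : 0 ∈ A) :
    OBlpr.{u} where
  plus := Subsemiring.closure (A : Set R)
  add_le h h' := hadd h h'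
  mul_le h h' := hmul h h'
  mon := A.comap (Subsemiring.closure (A : Set R)).subtype.toMonoidHom
  zero_mem := h0
  generates := closure_coe_preimage _

/-- An order preserving homomorphism of semirings that respects given multiplicative subsets
restricts to a morphism between the generated blueprints. -/
def ofSubmonoid.map {R' : Type v} [CommSemiring R'] [PartialOrder R']
    {hadd : ∀ {x y z t : R}, x ≤ y → z ≤ t → x + z ≤ y + t}
    {hmul : ∀ {x y z t : R}, x ≤ y → z ≤ t → x * z ≤ y * t} {A : Submonoid R} {h0 : 0 ∈ A}
    {hadd' : ∀ {x y z t : R'}, x ≤ y → z ≤ t → x + z ≤ y + t}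
    {hmul' : ∀ {x y z t : R'}, x ≤ y → z ≤ t → x * z ≤ y * t} {A' : Submonoid R'} {h0' : 0 ∈ A'}
    (f : Subsemiring.closure (A : Set R) →+* R')
    (hmono : ∀ x y, x ≤ y → f x ≤ f y)
    (hA : ∀ x : Subsemiring.closure (A : Set R), (x : R) ∈ A → f x ∈ A') :
    Hom (ofSubmonoid hadd hmul A h0) (ofSubmonoid hadd' hmul' A' h0') where
  toRingHom := f.codRestrict (Subsemiring.closure (A' : Set R')) (by
    have key : (⊤ : Subsemiring (Subsemiring.closure (A : Set R))) ≤
        (Subsemiring.closure (A' : Set R')).comap f := by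
      rw [← closure_coe_preimage (A : Set R), Subsemiring.closure_le]
      intro x hx
      exact Subsemiring.subset_closure (hA x hx)
    intro x
    exact key (Subsemiring.mem_top x))
  mono h := hmono _ _ h
  map_mon h := hA _ h

end Sub

/-- The subblueprint of `B` with underlying monoid `A`. -/
def OBlpr.sub (B : OBlpr.{u}) (A : Submonoid B.plus) (h0 : 0 ∈ A) : OBlpr.{u} :=
  ofSubmonoid B.add_le B.mul_le A h0

/-! ### Tensor products over the initial blueprint, pasteurization -/

/-- The multiplicative set `{0, 1, ε}` in the monoid semiring `ℕ[{1, ε}]`, where `{1, ε}` is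
realized as the group `ℤˣ = {1, -1}`. -/
def signMon : Submonoid (MonoidAlgebra ℕ ℤˣ) where
  carrier := {a | a = 0 ∨ ∃ s : ℤˣ, a = MonoidAlgebra.of ℕ ℤˣ s}
  one_mem' := Or.inr ⟨1, (map_one _).symm⟩
  mul_mem' := by
    rintro a b (rfl | ⟨s, rfl⟩) (rfl | ⟨t, rfl⟩)
    · simp
    · simp
    · simp
    · exact Or.inr ⟨s * t, (map_mul _ _ _).symm⟩

theorem signMon_generates : Subsemiring.closure (signMon : Set (MonoidAlgebra ℕ ℤˣ)) = ⊤ := by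
  rw [eq_top_iff]
  intro x _
  induction x using MonoidAlgebra.induction_on with
  | of s => exact Subsemiring.subset_closure (Or.inr ⟨s, rfl⟩)
  | add f g hf hg => exact Subsemiring.add_mem _ (hf trivial) (hg trivial)
  | smul r f hf => exact Subsemiring.nsmul_mem _ (hf trivial) r

/-- The relation `0 ≤ 1 + ε`. -/
def signRel (x y : MonoidAlgebra ℕ ℤˣ) : Prop :=
  x = 0 ∧ y = 1 + MonoidAlgebra.of ℕ ℤˣ (-1)

/-- The initial pasteurized blueprint `F₁^± = {0, 1, ε} // ⟨0 ≤ 1 + ε⟩`. -/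
def F1pm : OBlpr.{0} := pres signRel signMon (Or.inl rfl) signMon_generates

/-- The multiplicative set of pure tensors `a ⊗ b`, with `a` in `B^•` and `b` in `C^•`. -/
def pureTensors (B : OBlpr.{u}) (C : OBlpr.{v}) : Submonoid (B.plus ⊗[ℕ] C.plus) where
  carrier := {x | ∃ a ∈ B.mon, ∃ b ∈ C.mon, x = a ⊗ₜ[ℕ] b}
  one_mem' := ⟨1, B.mon.one_mem, 1, C.mon.one_mem, rfl⟩
  mul_mem' := by
    rintro _ _ ⟨a, ha, b, hb, rfl⟩ ⟨a', ha', b', hb', rfl⟩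
    exact ⟨a * a', B.mon.mul_mem ha ha', b * b', C.mon.mul_mem hb hb',
      Algebra.TensorProduct.tmul_mul_tmul _ _ _ _⟩

theorem pureTensors_generates (B : OBlpr.{u}) (C : OBlpr.{v}) :
    Subsemiring.closure (pureTensors B C : Set (B.plus ⊗[ℕ] C.plus)) = ⊤ := by
  have h1 : ∀ a : B.plus, a ⊗ₜ[ℕ] (1 : C.plus) ∈ Subsemiring.closure
      (pureTensors B C : Set (B.plus ⊗[ℕ] C.plus)) := by
    intro a
    have : (⊤ : Subsemiring B.plus) ≤ (Subsemiring.closure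
        (pureTensors B C : Set (B.plus ⊗[ℕ] C.plus))).comap
        (Algebra.TensorProduct.includeLeft (R := ℕ) (S := ℕ) (A := B.plus)
          (B := C.plus)).toRingHom := by
      rw [← B.generates, Subsemiring.closure_le]
      intro x hx
      exact Subsemiring.subset_closure ⟨x, hx, 1, C.mon.one_mem, rfl⟩
    exact this (Subsemiring.mem_top a)
  have h2 : ∀ b : C.plus, (1 : B.plus) ⊗ₜ[ℕ] b ∈ Subsemiring.closure
      (pureTensors B C : Set (B.plus ⊗[ℕ] C.plus)) := by
    intro b
    have : (⊤ : Subsemiring C.plus) ≤ (Subsemiring.closure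
        (pureTensors B C : Set (B.plus ⊗[ℕ] C.plus))).comap
        (Algebra.TensorProduct.includeRight (R := ℕ) (A := B.plus) (B := C.plus)).toRingHom := by
      rw [← C.generates, Subsemiring.closure_le]
      intro x hx
      exact Subsemiring.subset_closure ⟨1, B.mon.one_mem, x, hx, rfl⟩
    exact this (Subsemiring.mem_top b)
  rw [eq_top_iff]
  intro x _
  induction x using TensorProduct.induction_on with
  | zero => exact zero_mem _
  | tmul a b =>
    have := mul_mem (h1 a) (h2 b)
    rwa [Algebra.TensorProduct.tmul_mul_tmul, mul_one, one_mul] at this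
  | add x y hx hy => exact add_mem (hx trivial) (hy trivial)

/-- The tensor product of two ordered blueprints over the initial ordered blueprint `F₁`, whose
semiring is `ℕ`. -/
def tensor (B : OBlpr.{u}) (C : OBlpr.{v}) : OBlpr.{max u v} :=
  pres (R := B.plus ⊗[ℕ] C.plus)
    (fun x y => (∃ a a' : B.plus, a ≤ a' ∧ x = a ⊗ₜ[ℕ] 1 ∧ y = a' ⊗ₜ[ℕ] 1) ∨
      ∃ b b' : C.plus, b ≤ b' ∧ x = 1 ⊗ₜ[ℕ] b ∧ y = 1 ⊗ₜ[ℕ] b')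
    (pureTensors B C) ⟨0, B.zero_mem, 0, C.zero_mem, (TensorProduct.zero_tmul _ _).symm⟩
    (pureTensors_generates B C)

/-- The canonical morphism into the first factor. -/
def tensor.inl (B : OBlpr.{u}) (C : OBlpr.{v}) : Hom B (tensor B C) where
  toRingHom := (genCon _).mk'.comp (Algebra.TensorProduct.includeLeft (R := ℕ) (S := ℕ)
    (A := B.plus) (B := C.plus)).toRingHom
  mono h := GenLE.of (Or.inl ⟨_, _, h, rfl, rfl⟩)
  map_mon h := ⟨_, ⟨_, h, 1, C.mon.one_mem, rfl⟩, rfl⟩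

/-- `B` is pasteurized: every element has a unique weak inverse. -/
def OBlpr.IsPasteurized (B : OBlpr.{u}) : Prop :=
  ∀ a ∈ B.mon, ∃! b : B.plus, b ∈ B.mon ∧ 0 ≤ a + b

/-- The pasteurization of `B`: the quotient of `B ⊗ F₁^±` by the relations `a = a'` whenever the
elements `a` and `a'` have a common weak inverse. -/
def OBlpr.pasteurization (B : OBlpr.{u}) : OBlpr.{u} :=
  (tensor B F1pm).quot fun a a' => a ∈ (tensor B F1pm).mon ∧ a' ∈ (tensor B F1pm).mon ∧
    ∃ b ∈ (tensor B F1pm).mon, 0 ≤ a + b ∧ 0 ≤ a' + b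

/-- The canonical morphism from `B` to its pasteurization. -/
def OBlpr.toPasteurization (B : OBlpr.{u}) : Hom B B.pasteurization :=
  (tensor.inl B F1pm).comp (OBlpr.toQuot _ _)

/-! ### Pastures -/

/-- The linear extension `ℕ[B^×] → B^+` of the inclusion of the unit group. -/
def OBlpr.unitSum (B : OBlpr.{u}) : MonoidAlgebra ℕ B.unitGroup →+* B.plus :=
  (MonoidAlgebra.lift ℕ B.plus B.unitGroup B.unitGroup.subtype).toRingHom

/-- A pasture is a nontrivial pasteurized ordered blue field whose partial order is generated by
relations of the form `0 ≤ ∑ a_i`. As for every presentation of a blueprint, the order is regarded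
as a preorder on the formal sums of elements, i.e. on `ℕ[B^×]` for an ordered blue
field `B`. -/
structure OBlpr.IsPasture (B : OBlpr.{u}) : Prop where
  zero_ne_one : (0 : B.plus) ≠ 1
  field : ∀ a ∈ B.mon, a = 0 ∨ B.IsUnitElt a
  pasteurized : B.IsPasteurized
  purelyPositive : ∀ x y : MonoidAlgebra ℕ B.unitGroup,
    B.unitSum x ≤ B.unitSum y ↔ GenLE (fun u v => u = 0 ∧ 0 ≤ B.unitSum v) x y

/-- The category of pastures is the full subcategory of ordered blueprints with these objects. -/
structure Pasture extends OBlpr.{u} where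
  isPasture : toOBlpr.IsPasture

/-- The weak inverse `ε` of `1` in a pasteurized blueprint. -/
def OBlpr.eps (B : OBlpr.{u}) : B.plus :=
  Classical.epsilon fun e => e ∈ B.mon ∧ 0 ≤ 1 + e

theorem OBlpr.IsPasteurized.eps_spec {B : OBlpr.{u}} (h : B.IsPasteurized) :
    B.eps ∈ B.mon ∧ 0 ≤ 1 + B.eps :=
  Classical.epsilon_spec (h 1 B.mon.one_mem).exists

theorem OBlpr.IsPasteurized.eps_mul_eps {B : OBlpr.{u}} (h : B.IsPasteurized) :
    B.eps * B.eps = 1 := by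
  obtain ⟨h1, h2⟩ := h.eps_spec
  refine (h B.eps h1).unique ⟨B.mon.mul_mem h1 h1, ?_⟩ ⟨B.mon.one_mem, by rwa [add_comm]⟩
  have := B.mul_le (le_refl B.eps) h2
  rwa [mul_zero, mul_add, mul_one] at this

theorem Hom.map_eps {B : OBlpr.{u}} {C : OBlpr.{v}} (f : Hom B C) (hB : B.IsPasteurized)
    (hC : C.IsPasteurized) : f.toRingHom B.eps = C.eps := by
  obtain ⟨h1, h2⟩ := hB.eps_spec
  refine (hC 1 C.mon.one_mem).unique ⟨f.map_mon h1, ?_⟩ hC.eps_spec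
  have := f.mono h2
  rwa [map_zero, map_add, map_one] at this

/-! ### The Krasner hyperfield -/

/-- The order of the Krasner hyperfield on `ℕ`: it is generated by the relations `0 ≤ n` for
`n ≠ 1`. -/
@[reducible] def krasnerOrder : PartialOrder ℕ where
  le x y := ∃ n, n ≠ 1 ∧ y = x + n
  lt x y := (∃ n, n ≠ 1 ∧ y = x + n) ∧ ¬∃ n, n ≠ 1 ∧ x = y + n
  lt_iff_le_not_ge _ _ := Iff.rfl
  le_refl x := ⟨0, by decide, rfl⟩
  le_trans := by
    rintro x y z ⟨n, hn, rfl⟩ ⟨m, hm, rfl⟩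
    exact ⟨n + m, by omega, by omega⟩
  le_antisymm := by
    rintro x y ⟨n, hn, rfl⟩ ⟨m, hm, h⟩
    omega

/-- The ordered blueprint `({0, 1}, ℕ, ≤)` of the Krasner hyperfield. -/
def krasner : OBlpr.{0} :=
  letI := krasnerOrder
  { plus := ℕ
    add_le := by
      rintro x y z t ⟨n, hn, rfl⟩ ⟨m, hm, rfl⟩
      exact ⟨n + m, by omega, by omega⟩
    mul_le := by
      rintro x y z t ⟨n, hn, rfl⟩ ⟨m, hm, rfl⟩
      refine ⟨x * m + n * z + n * m, ?_, by ring⟩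
      intro h
      have h1 : x * m ≠ 1 := fun h => hm (Nat.eq_one_of_mul_eq_one_left h)
      have h2 : n * z ≠ 1 := fun h => hn (Nat.eq_one_of_mul_eq_one_right h)
      have h3 : n * m ≠ 1 := fun h => hm (Nat.eq_one_of_mul_eq_one_left h)
      omega
    mon :=
      { carrier := {0, 1}
        one_mem' := Or.inr rfl
        mul_mem' := by rintro a b (rfl | rfl) (rfl | rfl) <;> simp }
    zero_mem := Or.inl rfl
    generates := by
      rw [eq_top_iff]
      intro n _
      exact natCast_mem _ n }
/-- The identity of `ℕ`, viewed as a map to the semiring of the Krasner hyperfield. -/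
def ofNatK : ℕ →+* krasner.plus := RingHom.id ℕ

theorem ofNatK_le {x y : ℕ} : ofNatK x ≤ ofNatK y ↔ ∃ n, n ≠ 1 ∧ y = x + n := Iff.rfl

theorem ofNatK_mem {x : ℕ} : ofNatK x ∈ krasner.mon ↔ x = 0 ∨ x = 1 := Iff.rfl

theorem ofNatK_injective : Function.Injective ofNatK := fun _ _ h => h

theorem ofNatK_surjective : Function.Surjective ofNatK := fun x => ⟨x, rfl⟩

theorem krasner_zero_le {y : ℕ} : 0 ≤ ofNatK y ↔ y ≠ 1 := by
  rw [← map_zero ofNatK, ofNatK_le]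
  constructor
  · rintro ⟨n, hn, h⟩
    omega
  · exact fun h => ⟨y, h, (zero_add y).symm⟩

theorem unitSum_mono {B : OBlpr.{u}} {x y : MonoidAlgebra ℕ B.unitGroup}
    (h : GenLE (fun u v => u = 0 ∧ 0 ≤ B.unitSum v) x y) : B.unitSum x ≤ B.unitSum y := by
  refine GenLE.map (D := B) B.unitSum ?_ h
  rintro _ y ⟨rfl, h⟩
  rwa [map_zero]

theorem krasner_isUnitElt {x : ℕ} : krasner.IsUnitElt (ofNatK x) ↔ x = 1 := by
  constructor
  · rintro ⟨_, b, _, h⟩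
    obtain ⟨b, rfl⟩ := ofNatK_surjective b
    rw [← map_mul, ← map_one ofNatK] at h
    exact Nat.eq_one_of_mul_eq_one_right (ofNatK_injective h)
  · rintro rfl
    rw [map_one]
    exact ⟨krasner.mon.one_mem, 1, krasner.mon.one_mem, one_mul 1⟩

theorem krasner_pasteurized : krasner.IsPasteurized := by
  intro a ha
  obtain ⟨a, rfl⟩ := ofNatK_surjective a
  rw [ofNatK_mem] at ha
  refine ⟨ofNatK a, ⟨ha, ?_⟩, ?_⟩
  · rw [← map_add, krasner_zero_le]
    omega
  · intro b hb
    obtain ⟨b, rfl⟩ := ofNatK_surjective b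
    rw [ofNatK_mem, ← map_add, krasner_zero_le] at hb
    congr 1
    omega

theorem krasner_algebra_eq (x : MonoidAlgebra ℕ krasner.unitGroup) :
    ∃ n : ℕ, x = (n : MonoidAlgebra ℕ krasner.unitGroup) := by
  induction x using MonoidAlgebra.induction_on with
  | of a =>
    obtain ⟨a, ha⟩ := a
    obtain ⟨a, rfl⟩ := ofNatK_surjective a
    obtain rfl := krasner_isUnitElt.1 ha
    refine ⟨1, ?_⟩
    rw [Nat.cast_one, ← map_one (MonoidAlgebra.of ℕ krasner.unitGroup)]
    rfl
  | add f g hf hg =>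
    obtain ⟨n, rfl⟩ := hf
    obtain ⟨m, rfl⟩ := hg
    exact ⟨n + m, by push_cast; rfl⟩
  | smul r f hf =>
    obtain ⟨n, rfl⟩ := hf
    exact ⟨r * n, by push_cast; rw [nsmul_eq_mul]⟩

theorem krasner_isPasture : krasner.IsPasture where
  zero_ne_one := Nat.zero_ne_one
  field := by
    intro a ha
    obtain ⟨a, rfl⟩ := ofNatK_surjective a
    rcases ofNatK_mem.1 ha with rfl | h
    · exact Or.inl (map_zero _)
    · exact Or.inr (krasner_isUnitElt.2 h)
  pasteurized := krasner_pasteurized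
  purelyPositive := by
    intro x y
    refine ⟨?_, unitSum_mono⟩
    obtain ⟨n, rfl⟩ := krasner_algebra_eq x
    obtain ⟨m, rfl⟩ := krasner_algebra_eq y
    rw [map_natCast, map_natCast, ← map_natCast ofNatK, ← map_natCast ofNatK, ofNatK_le]
    rintro ⟨k, hk, h⟩
    obtain rfl : m = n + k := h
    have := GenLE.add (GenLE.refl (S := fun u v => u = 0 ∧ 0 ≤ krasner.unitSum v)
      (n : MonoidAlgebra ℕ krasner.unitGroup))
      (GenLE.of (y := (k : MonoidAlgebra ℕ krasner.unitGroup)) ⟨rfl, by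
        rw [map_natCast, ← map_natCast ofNatK, krasner_zero_le]
        exact hk⟩)
    rwa [add_zero, ← Nat.cast_add] at this

/-- The Krasner hyperfield `𝕂` as a pasture. -/
abbrev Krasner : Pasture.{0} := ⟨krasner, krasner_isPasture⟩

theorem OBlpr.IsPasture.isUnitElt {F : OBlpr.{u}} (hF : F.IsPasture) {a : F.plus}
    (ha : a ∈ F.mon) (h : a ≠ 0) : F.IsUnitElt a :=
  (hF.field a ha).resolve_left h

theorem OBlpr.IsPasture.unit_ne_zero {F : OBlpr.{u}} (hF : F.IsPasture) {a : F.plus}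
    (ha : F.IsUnitElt a) : a ≠ 0 := by
  rintro rfl
  obtain ⟨_, b, _, h⟩ := ha
  exact hF.zero_ne_one (by rw [← h, zero_mul])

theorem OBlpr.IsPasture.not_zero_le {F : OBlpr.{u}} (hF : F.IsPasture) {a : F.plus}
    (ha : F.IsUnitElt a) : ¬ 0 ≤ a := by
  intro h
  have h0 : (0 : F.plus) ≤ 0 + 0 := by rw [add_zero]
  exact hF.unit_ne_zero ha ((hF.pasteurized 0 F.zero_mem).unique ⟨ha.1, by rwa [zero_add]⟩
    ⟨F.zero_mem, h0⟩)

theorem OBlpr.unitSum_of (F : OBlpr.{u}) (a : F.unitGroup) :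
    F.unitSum (MonoidAlgebra.of ℕ _ a) = a := by
  simp [OBlpr.unitSum]

theorem OBlpr.IsPasture.unitSum_bijective {F : OBlpr.{u}} (hF : F.IsPasture) :
    Function.Bijective F.unitSum := by
  constructor
  · intro x y h
    have key : ∀ x y : MonoidAlgebra ℕ F.unitGroup,
        GenLE (fun u v => u = 0 ∧ 0 ≤ F.unitSum v) x y →
        ∃ z, y = x + z := by
      intro x y h
      induction h with
      | @of x y h => exact ⟨y, by rw [h.1, zero_add]⟩
      | refl x => exact ⟨0, (add_zero x).symm⟩
      | trans _ _ h h' =>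
        obtain ⟨z, rfl⟩ := h
        obtain ⟨z', rfl⟩ := h'
        exact ⟨z + z', add_assoc _ _ _⟩
      | add _ _ h h' =>
        obtain ⟨z, rfl⟩ := h
        obtain ⟨z', rfl⟩ := h'
        exact ⟨z + z', by ring⟩
      | @mul x _ t _ _ _ h h' =>
        obtain ⟨z, rfl⟩ := h
        obtain ⟨z', rfl⟩ := h'
        exact ⟨x * z' + z * t + z * z', by ring⟩
    obtain ⟨z, rfl⟩ := key _ _ ((hF.purelyPositive x y).1 h.le)
    obtain ⟨z', hz⟩ := key _ _ ((hF.purelyPositive _ x).1 h.ge)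
    ext i
    have := congrArg (fun f => f.coeff i) hz
    simp at this
    simp
    omega
  · rw [← RingHom.rangeS_eq_top, eq_top_iff, ← F.generates, Subsemiring.closure_le]
    intro a ha
    rcases hF.field a ha with rfl | h
    · exact (F.unitSum.rangeS).zero_mem
    · exact ⟨_, F.unitSum_of ⟨a, h⟩⟩

/-- The number of terms of a formal sum. -/
def termCount (G : Type u) [CommMonoid G] : MonoidAlgebra ℕ G →+* ℕ :=
  (MonoidAlgebra.lift ℕ ℕ G 1).toRingHom

theorem termCount_of {G : Type u} [CommMonoid G] (a : G) :
    termCount G (MonoidAlgebra.of ℕ _ a) = 1 := by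
  simp [termCount]

theorem termCount_eq_zero {G : Type u} [CommMonoid G] {x : MonoidAlgebra ℕ G}
    (h : termCount G x = 0) : x = 0 := by
  induction x using MonoidAlgebra.induction_on with
  | of a => rw [termCount_of] at h; exact absurd h one_ne_zero
  | add f g hf hg =>
    rw [map_add, Nat.add_eq_zero_iff] at h
    rw [hf h.1, hg h.2, add_zero]
  | smul r f hf =>
    rw [map_nsmul, smul_eq_mul, mul_eq_zero] at h
    rcases h with rfl | h
    · exact zero_smul _ _
    · rw [hf h, smul_zero]

theorem termCount_eq_one {G : Type u} [CommMonoid G] {x : MonoidAlgebra ℕ G}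
    (h : termCount G x = 1) : ∃ a, x = MonoidAlgebra.of ℕ _ a := by
  induction x using MonoidAlgebra.induction_on with
  | of a => exact ⟨a, rfl⟩
  | add f g hf hg =>
    rw [map_add, Nat.add_eq_one_iff] at h
    rcases h with ⟨h1, h2⟩ | ⟨h1, h2⟩
    · obtain ⟨a, ha⟩ := hg h2
      exact ⟨a, by rw [termCount_eq_zero h1, ha, zero_add]⟩
    · obtain ⟨a, ha⟩ := hf h1
      exact ⟨a, by rw [termCount_eq_zero h2, ha, add_zero]⟩
  | smul r f hf =>
    rw [map_nsmul, smul_eq_mul] at h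
    obtain ⟨a, ha⟩ := hf (Nat.eq_one_of_mul_eq_one_left h)
    exact ⟨a, by rw [Nat.eq_one_of_mul_eq_one_right h, one_smul, ha]⟩

theorem hom_ext_mon {B : OBlpr.{u}} {C : OBlpr.{v}} {f g : Hom B C}
    (h : ∀ a ∈ B.mon, f.toRingHom a = g.toRingHom a) : f = g := by
  ext x
  have : (⊤ : Subsemiring B.plus) ≤ f.toRingHom.eqLocusS g.toRingHom := by
    rw [← B.generates, Subsemiring.closure_le]
    exact h
  exact this (Subsemiring.mem_top x)

/-- Every pasture has a unique morphism to the Krasner hyperfield. -/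
theorem unique_terminal (F : Pasture.{u}) : Nonempty (Unique (Hom F.toOBlpr krasner)) := by
  have hF := F.isPasture
  let e : MonoidAlgebra ℕ F.unitGroup ≃+* F.plus :=
    RingEquiv.ofBijective F.unitSum hF.unitSum_bijective
  have he : ∀ a : F.unitGroup, e.symm (a : F.plus) = MonoidAlgebra.of ℕ _ a := by
    intro a
    rw [RingEquiv.symm_apply_eq]
    exact (F.unitSum_of a).symm
  let t : F.plus →+* krasner.plus := (ofNatK.comp (termCount _)).comp (e.symm : F.plus →+* MonoidAlgebra ℕ F.unitGroup)
  have ht : ∀ x, t (e x) = ofNatK (termCount _ x) := fun x =>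
    congrArg (fun z => ofNatK (termCount _ z)) (e.symm_apply_apply x)
  have ht' : ∀ a, F.IsUnitElt a → t a = ofNatK 1 := by
    intro a ha
    have h1 := ht (MonoidAlgebra.of ℕ _ ⟨a, ha⟩)
    rw [← he ⟨a, ha⟩, e.apply_symm_apply, he ⟨a, ha⟩, termCount_of] at h1
    exact h1
  refine ⟨⟨⟨⟨t, ?_, ?_⟩⟩, ?_⟩⟩
  · intro x y h
    obtain ⟨x, rfl⟩ := e.surjective x
    obtain ⟨y, rfl⟩ := e.surjective y
    rw [ht, ht]
    refine GenLE.map (D := krasner) (ofNatK.comp (termCount F.unitGroup)) ?_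
      ((hF.purelyPositive x y).1 h)
    rintro _ y ⟨rfl, hy⟩
    rw [map_zero, RingHom.comp_apply, krasner_zero_le]
    intro h1
    obtain ⟨a, rfl⟩ := termCount_eq_one h1
    rw [F.unitSum_of] at hy
    exact hF.not_zero_le a.2 hy
  · intro a ha
    rcases hF.field a ha with rfl | h
    · rw [map_zero]; exact krasner.zero_mem
    · rw [ht' a h]
      exact Or.inr rfl
  · intro t'
    refine hom_ext_mon fun a ha => ?_
    rcases hF.field a ha with rfl | h
    · rw [map_zero, map_zero]
    · have h2 := IsUnitElt.map t' h
      obtain ⟨n, hn⟩ := ofNatK_surjective (t'.toRingHom a)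
      rw [← hn] at h2
      rw [← hn, krasner_isUnitElt.1 h2]
      exact (ht' a h).symm

/-- The terminal map `t_F : F → 𝕂`, the unique morphism from a pasture `F` to `𝕂`. -/
def terminalMap (F : Pasture.{u}) : Hom F.toOBlpr Krasner.toOBlpr :=
  (Classical.choice (unique_terminal F)).default

open TopologicalSpace

/-! ### Ordered blueprinted spaces -/

/-- An ordered blueprinted space: a topological space with a sheaf of ordered blueprints. The last
two fields say that for every covering `U = ⋃ V i`, the blueprint of sections over `U` is the
equalizer in the category of ordered blueprints: its elements are the matching families of
elements, and its order is the restriction of the order of the product. -/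
structure OBSpace where
  pt : Type u
  [top : TopologicalSpace pt]
  sec : Opens pt → OBlpr.{u}
  res : ∀ {U V : Opens pt}, V ≤ U → Hom (sec U) (sec V)
  res_self : ∀ (U : Opens pt) (s : (sec U).plus), (res (le_refl U)).toRingHom s = s
  res_res : ∀ {U V W : Opens pt} (h : V ≤ U) (h' : W ≤ V) (s : (sec U).plus),
    (res h').toRingHom ((res h).toRingHom s) = (res (h'.trans h)).toRingHom s
  le_of_local : ∀ {U : Opens pt} {ι : Type u} (V : ι → Opens pt) (hV : ∀ i, V i ≤ U),
    U ≤ iSup V → ∀ s t : (sec U).plus,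
    (∀ i, (res (hV i)).toRingHom s ≤ (res (hV i)).toRingHom t) → s ≤ t
  glue : ∀ {U : Opens pt} {ι : Type u} (V : ι → Opens pt) (hV : ∀ i, V i ≤ U), U ≤ iSup V →
    ∀ a : ∀ i, (sec (V i)).plus, (∀ i, a i ∈ (sec (V i)).mon) →
    (∀ i j, (res (inf_le_left : V i ⊓ V j ≤ V i)).toRingHom (a i) =
      (res (inf_le_right : V i ⊓ V j ≤ V j)).toRingHom (a j)) →
    ∃ s ∈ (sec U).mon, ∀ i, (res (hV i)).toRingHom s = a i

attribute [instance] OBSpace.top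

/-- The germ at `x` of the section `s` over `U` is a unit of the stalk at `x`, that is, `s`
becomes a unit over some smaller open neighbourhood of `x`. -/
def OBSpace.IsUnitAt (X : OBSpace.{u}) {U : Opens X.pt} (s : (X.sec U).plus) (x : X.pt) : Prop :=
  ∃ (V : Opens X.pt) (h : V ≤ U), x ∈ V ∧ (X.sec V).IsUnitElt ((X.res h).toRingHom s)

/-- A morphism of ordered blueprinted spaces: a continuous map `φ : X → Y` with a morphism of
sheaves `φ⁻¹ O_Y → O_X`, given by compatible morphisms `O_Y(V) → O_X(U)` for all opens with
`φ(U) ⊆ V`, that is local: non-units of stalks are sent to non-units. -/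
structure OBSpace.Hom (X : OBSpace.{u}) (Y : OBSpace.{v}) where
  base : X.pt → Y.pt
  cont : Continuous base
  app : ∀ (V : Opens Y.pt) (U : Opens X.pt), (∀ x ∈ U, base x ∈ V) → OB.Hom (Y.sec V) (X.sec U)
  natural : ∀ {V V' : Opens Y.pt} {U U' : Opens X.pt} (hV : V' ≤ V) (hU : U' ≤ U)
    (h : ∀ x ∈ U, base x ∈ V) (h' : ∀ x ∈ U', base x ∈ V') (s : (Y.sec V).plus),
    (X.res hU).toRingHom ((app V U h).toRingHom s) =
      (app V' U' h').toRingHom ((Y.res hV).toRingHom s)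
  isLocal : ∀ (V : Opens Y.pt) (U : Opens X.pt) (h : ∀ x ∈ U, base x ∈ V), ∀ s ∈ (Y.sec V).mon,
    ∀ x ∈ U, X.IsUnitAt ((app V U h).toRingHom s) x → Y.IsUnitAt s (base x)

theorem OBSpace.Hom.ext' {X : OBSpace.{u}} {Y : OBSpace.{v}} {f g : X.Hom Y}
    (h : ∀ x, f.base x = g.base x)
    (h' : ∀ V U hf hg, ∀ s ∈ (Y.sec V).mon,
      (f.app V U hf).toRingHom s = (g.app V U hg).toRingHom s) : f = g := by
  obtain ⟨fb, fc, fa, fn, fl⟩ := f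
  obtain ⟨gb, gc, ga, gn, gl⟩ := g
  obtain rfl : fb = gb := funext h
  congr
  funext V U hU
  exact hom_ext_mon (h' V U hU hU)

/-- Composition of morphisms, first `f`, then `g`. -/
def OBSpace.Hom.comp {X : OBSpace.{u}} {Y : OBSpace.{v}} {Z : OBSpace.{w}} (f : X.Hom Y)
    (g : Y.Hom Z) : X.Hom Z where
  base := g.base ∘ f.base
  cont := g.cont.comp f.cont
  app V U h := (g.app V ((Opens.comap ⟨g.base, g.cont⟩ V)) (fun _ hx => hx)).comp
    (f.app (Opens.comap ⟨g.base, g.cont⟩ V) U h)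
  natural {V V' U U'} hV hU h h' s := by
    have h1 := f.natural (V := Opens.comap ⟨g.base, g.cont⟩ V)
      (V' := Opens.comap ⟨g.base, g.cont⟩ V') (fun x hx => hV hx) hU h h'
      ((g.app V _ (fun _ hx => hx)).toRingHom s)
    have h2 := g.natural (U := Opens.comap ⟨g.base, g.cont⟩ V)
      (U' := Opens.comap ⟨g.base, g.cont⟩ V') hV (fun x hx => hV hx) (fun _ hx => hx)
      (fun _ hx => hx) s
    exact h1.trans (congrArg _ h2)
  isLocal V U h s hs x hx hu := g.isLocal V _ _ s hs _ (h x hx)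
    (f.isLocal _ U _ _ ((g.app V _ _).map_mon hs) x hx hu)

/-! ### Spaces of locally represented sections -/

/-- Data for a sheaf of locally represented sections on a topological space `X`: a blueprint
`A x` for every point `x`, and a set `ι` of fractions, where `rep i x z` says that the fraction
`i` is defined at `x` and has the value `z`. -/
structure FracData (X : Type u) [TopologicalSpace X] where
  A : X → OBlpr.{u}
  ι : Type u
  rep : ι → ∀ x, (A x).plus → Prop
  rep_mon : ∀ {i x z}, rep i x z → z ∈ (A x).mon
  rep_zero : ∃ i, ∀ x, rep i x 0
  rep_one : ∃ i, ∀ x, rep i x 1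
  rep_mul : ∀ i j, ∃ k, ∀ x z w, rep i x z → rep j x w → rep k x (z * w)

namespace FracData

variable {X : Type u} [TopologicalSpace X] (D : FracData X)

/-- The locally represented sections over `U`, as a multiplicative subset of the product of the
semirings of the blueprints `A x` for `x` in `U`. -/
def locRep (U : Opens X) : Submonoid (∀ x : U, (D.A x).plus) where
  carrier := {s | ∀ x : U, ∃ V : Opens X, ↑x ∈ V ∧ ∃ i, ∀ y : U, ↑y ∈ V → D.rep i y (s y)}
  one_mem' := fun x => ⟨U, x.2, D.rep_one.choose, fun y _ => D.rep_one.choose_spec y⟩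
  mul_mem' := by
    intro s t hs ht x
    obtain ⟨V, hV, i, hi⟩ := hs x
    obtain ⟨W, hW, j, hj⟩ := ht x
    obtain ⟨k, hk⟩ := D.rep_mul i j
    exact ⟨V ⊓ W, ⟨hV, hW⟩, k, fun y hy => hk _ _ _ (hi y hy.1) (hj y hy.2)⟩

theorem zero_mem_locRep (U : Opens X) : 0 ∈ D.locRep U :=
  fun x => ⟨U, x.2, D.rep_zero.choose, fun y _ => D.rep_zero.choose_spec y⟩

/-- The blueprint of sections over `U`: its elements are the locally represented sections, its
semiring is generated by them in the product of the semirings of the `A x`, and its order is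
defined pointwise. -/
def sections (U : Opens X) : OBlpr.{u} :=
  ofSubmonoid (R := ∀ x : U, (D.A x).plus)
    (by intro _ _ _ _ h h' x; exact (D.A x).add_le (h x) (h' x))
    (by intro _ _ _ _ h h' x; exact (D.A x).mul_le (h x) (h' x))
    (D.locRep U) (D.zero_mem_locRep U)

/-- The value of a section at a point. -/
def eval {U : Opens X} (x : X) (hx : x ∈ U) : Hom (D.sections U) (D.A x) where
  toRingHom := (Pi.evalRingHom (fun x : U => (D.A x).plus) ⟨x, hx⟩).comp
    (Subsemiring.closure (D.locRep U : Set (∀ x : U, (D.A x).plus))).subtype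
  mono h := h ⟨x, hx⟩
  map_mon := by
    intro a ha
    obtain ⟨V, hV, i, hi⟩ := ha ⟨x, hx⟩
    exact D.rep_mon (hi ⟨x, hx⟩ hV)

theorem mem_sections_mon {U : Opens X} {s : (D.sections U).plus} :
    s ∈ (D.sections U).mon ↔ ∀ x (_ : x ∈ U), ∃ V : Opens X, x ∈ V ∧ ∃ i, ∀ y (hy : y ∈ U), y ∈ V →
      D.rep i y ((D.eval y hy).toRingHom s) :=
  ⟨fun h x hx => by
    obtain ⟨V, hV, i, hi⟩ := h ⟨x, hx⟩
    exact ⟨V, hV, i, fun y hy hyV => hi ⟨y, hy⟩ hyV⟩, fun h x => by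
    obtain ⟨V, hV, i, hi⟩ := h x x.2
    exact ⟨V, hV, i, fun y hyV => hi y y.2 hyV⟩⟩

theorem sections_le {U : Opens X} {s t : (D.sections U).plus} :
    s ≤ t ↔ ∀ x (hx : x ∈ U), (D.eval x hx).toRingHom s ≤ (D.eval x hx).toRingHom t :=
  ⟨fun h x hx => h ⟨x, hx⟩, fun h x => h x x.2⟩

theorem sections_ext {U : Opens X} {s t : (D.sections U).plus}
    (h : ∀ x (hx : x ∈ U), (D.eval x hx).toRingHom s = (D.eval x hx).toRingHom t) : s = t :=
  le_antisymm ((D.sections_le).2 fun x hx => (h x hx).le)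
    ((D.sections_le).2 fun x hx => (h x hx).ge)

/-- The element of `sections U` given by a locally represented family of values. -/
def mkSection {U : Opens X} (s : ∀ x : U, (D.A x).plus) (hs : s ∈ D.locRep U) :
    (D.sections U).plus :=
  ⟨s, Subsemiring.subset_closure hs⟩

theorem mkSection_mem {U : Opens X} (s : ∀ x : U, (D.A x).plus) (hs : s ∈ D.locRep U) :
    D.mkSection s hs ∈ (D.sections U).mon := hs

theorem eval_mkSection {U : Opens X} (s : ∀ x : U, (D.A x).plus) (hs : s ∈ D.locRep U) (x : X)
    (hx : x ∈ U) : (D.eval x hx).toRingHom (D.mkSection s hs) = s ⟨x, hx⟩ := rfl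

/-- A morphism into a blueprint of sections from a compatible family of morphisms to the `A x`. -/
def toSections {U : Opens X} {B : OBlpr.{v}} (f : ∀ x ∈ U, Hom B (D.A x))
    (hf : ∀ b ∈ B.mon, (fun x : U => (f x x.2).toRingHom b) ∈ D.locRep U) :
    Hom B (D.sections U) where
  toRingHom := (RingHom.pi fun x : U => (f x x.2).toRingHom).codRestrict
    (Subsemiring.closure (D.locRep U : Set (∀ x : U, (D.A x).plus))) (by
      have : (⊤ : Subsemiring B.plus) ≤ (Subsemiring.closure (D.locRep U : Set
          (∀ x : U, (D.A x).plus))).comap (RingHom.pi fun x : U => (f x x.2).toRingHom) := by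
        rw [← B.generates, Subsemiring.closure_le]
        intro b hb
        exact Subsemiring.subset_closure (hf b hb)
      exact fun x => this (Subsemiring.mem_top x))
  mono h := fun x => (f x x.2).mono h
  map_mon h := hf _ h

theorem eval_toSections {U : Opens X} {B : OBlpr.{v}} (f : ∀ x ∈ U, Hom B (D.A x))
    (hf : ∀ b ∈ B.mon, (fun x : U => (f x x.2).toRingHom b) ∈ D.locRep U) (b : B.plus) (x : X)
    (hx : x ∈ U) :
    (D.eval x hx).toRingHom ((D.toSections f hf).toRingHom b) = (f x hx).toRingHom b := rfl

/-- The ordered blueprinted space of locally represented sections. -/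
def space : OBSpace.{u} where
  pt := X
  sec := D.sections
  res {U V} h := D.toSections (fun x hx => D.eval x (h hx)) (by
    intro s hs x
    obtain ⟨W, hW, i, hi⟩ := D.mem_sections_mon.1 hs x (h x.2)
    exact ⟨W, hW, i, fun y hy => hi y (h y.2) hy⟩)
  res_self U s := rfl
  res_res h h' s := rfl
  le_of_local {U ι} V hV hU s t h := by
    rw [sections_le]
    intro x hx
    obtain ⟨i, hi⟩ := Opens.mem_iSup.1 (hU hx)
    exact h i ⟨x, hi⟩
  glue {U ι} V hV hU a ha hc := by
    have hx : ∀ x : U, ∃ i, ↑x ∈ V i := fun x => Opens.mem_iSup.1 (hU x.2)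
    choose j hj using hx
    have key : ∀ (x : U) (i : ι) (hi : ↑x ∈ V i), (D.eval ↑x (hj x)).toRingHom (a (j x)) =
        (D.eval ↑x hi).toRingHom (a i) := by
      intro x i hi
      have := congrArg (D.eval ↑x (show ↑x ∈ V (j x) ⊓ V i from ⟨hj x, hi⟩)).toRingHom (hc (j x) i)
      exact this
    refine ⟨D.mkSection (fun x => (D.eval ↑x (hj x)).toRingHom (a (j x))) ?_, D.mkSection_mem _ _,
      ?_⟩
    · intro x
      obtain ⟨W, hW, k, hk⟩ := D.mem_sections_mon.1 (ha (j x)) x (hj x)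
      refine ⟨W ⊓ V (j x), ⟨hW, hj x⟩, k, fun y hy => ?_⟩
      beta_reduce
      rw [key y (j x) hy.2]
      exact hk y hy.2 hy.1
    · intro i
      refine D.sections_ext fun x hx => ?_
      exact key ⟨x, hV i hx⟩ i hx

theorem eval_res {U V : Opens X} (h : V ≤ U) (s : (D.sections U).plus) (x : X) (hx : x ∈ V) :
    (D.eval x hx).toRingHom ((D.space.res h).toRingHom s) = (D.eval x (h hx)).toRingHom s := rfl

theorem isUnitAt_of {U V' : Opens X} {s : (D.sections U).plus} (hs : s ∈ (D.sections U).mon)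
    (h : V' ≤ U) {x : X} (hx : x ∈ V') (t : ∀ y ∈ V', (D.A y).plus) (i : D.ι)
    (ht : ∀ y hy, D.rep i y (t y hy))
    (hst : ∀ y hy, (D.eval y (h hy)).toRingHom s * t y hy = 1) : D.space.IsUnitAt s x := by
  have hloc : (fun y : V' => t y y.2) ∈ D.locRep V' := fun y => ⟨V', y.2, i, fun z _ => ht z z.2⟩
  refine ⟨V', h, hx, (D.space.res h).map_mon hs, D.mkSection _ hloc, D.mkSection_mem _ hloc,
    D.sections_ext fun y hy => ?_⟩
  exact ((D.eval y hy).toRingHom.map_mul _ _).trans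
    ((hst y hy).trans (D.eval y hy).toRingHom.map_one.symm)

theorem eval_of_isUnitAt {U : Opens X} {s : (D.sections U).plus} {x : X}
    (h : D.space.IsUnitAt s x) (hx : x ∈ U) :
    ∃ z ∈ (D.A x).mon, (D.eval x hx).toRingHom s * z = 1 := by
  obtain ⟨V, hV, hxV, _, t, ht, hst⟩ := h
  refine ⟨_, (D.eval x hxV).map_mon ht, ?_⟩
  have h1 := congrArg (D.eval x hxV).toRingHom hst
  exact (((D.eval x hxV).toRingHom.map_mul _ _).symm.trans h1).trans
    (D.eval x hxV).toRingHom.map_one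

end FracData

/-! ### Localizations -/

section Localization

variable (B : OBlpr.{u}) (S : Submonoid B.plus)

/-- The order of a localization: `a / s ≤ b / s` whenever `a ≤ b` (two fractions are compared after
passing to a common denominator). -/
@[reducible] def locOrder : PartialOrder (Localization S) where
  le x y := ∃ (a b : B.plus) (s : S), a ≤ b ∧ x = Localization.mk a s ∧ y = Localization.mk b s
  le_refl x := by
    induction x using Localization.induction_on with
    | H x => exact ⟨x.1, x.1, x.2, le_rfl, rfl, rfl⟩
  le_trans := by
    rintro x y z ⟨a, b, s, h, rfl, rfl⟩ ⟨b', c, t, h', hb, rfl⟩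
    rw [Localization.mk_eq_mk_iff, Localization.r_iff_exists] at hb
    obtain ⟨v, hv⟩ := hb
    refine ⟨v * (t * a), v * (s * c), v * (t * s), ?_, ?_, ?_⟩
    · calc (v : B.plus) * (t * a) ≤ v * (t * b) := B.mul_le le_rfl (B.mul_le le_rfl h)
        _ = v * (s * b') := hv
        _ ≤ v * (s * c) := B.mul_le le_rfl (B.mul_le le_rfl h')
    · rw [Localization.mk_eq_mk_iff, Localization.r_iff_exists]
      exact ⟨1, by push_cast; ring⟩
    · rw [Localization.mk_eq_mk_iff, Localization.r_iff_exists]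
      exact ⟨1, by push_cast; ring⟩
  le_antisymm := by
    rintro x y ⟨a, b, s, h, rfl, rfl⟩ ⟨b', a', t, h', hb, ha⟩
    rw [Localization.mk_eq_mk_iff, Localization.r_iff_exists] at ha hb ⊢
    obtain ⟨v, hv⟩ := hb
    obtain ⟨w, hw⟩ := ha
    have h1 : (w * v * t : B.plus) * a ≤ w * v * t * b := B.mul_le le_rfl h
    have h2 : (w * v * s : B.plus) * b' ≤ w * v * s * a' := B.mul_le le_rfl h'
    have h3 : (w * v * t : B.plus) * a = w * v * t * b := by
      refine le_antisymm h1 ?_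
      calc (w * v * t : B.plus) * b = w * (v * (t * b)) := by ring
        _ = w * v * s * b' := by rw [hv]; ring
        _ ≤ w * v * s * a' := h2
        _ = v * (w * (s * a')) := by ring
        _ = w * v * t * a := by rw [← hw]; ring
    refine ⟨w * v * t, ?_⟩
    push_cast
    calc (w * v * t : B.plus) * (s * a) = s * (w * v * t * a) := by ring
      _ = w * v * t * (s * b) := by rw [h3]; ring

/-- The multiplicative set of fractions `a / s` with `a` in `B^•`. -/
def locMon : Submonoid (Localization S) where
  carrier := {x | ∃ a ∈ B.mon, ∃ s : S, x = Localization.mk a s}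
  one_mem' := ⟨1, B.mon.one_mem, 1, Localization.mk_one.symm⟩
  mul_mem' := by
    rintro _ _ ⟨a, ha, s, rfl⟩ ⟨b, hb, t, rfl⟩
    exact ⟨a * b, B.mon.mul_mem ha hb, s * t, Localization.mk_mul _ _ _ _⟩

theorem locMon_generates : Subsemiring.closure (locMon B S : Set (Localization S)) = ⊤ := by
  rw [eq_top_iff]
  intro x _
  induction x using Localization.induction_on with
  | H x =>
    obtain ⟨a, s⟩ := x
    have h1 : algebraMap B.plus (Localization S) a ∈
        Subsemiring.closure (locMon B S : Set (Localization S)) := by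
      have : (⊤ : Subsemiring B.plus) ≤ (Subsemiring.closure
          (locMon B S : Set (Localization S))).comap (algebraMap B.plus (Localization S)) := by
        rw [← B.generates, Subsemiring.closure_le]
        intro b hb
        exact Subsemiring.subset_closure ⟨b, hb, 1, (Localization.mk_one_eq_algebraMap b).symm⟩
      exact this (Subsemiring.mem_top a)
    have h2 : Localization.mk (1 : B.plus) s ∈
        Subsemiring.closure (locMon B S : Set (Localization S)) :=
      Subsemiring.subset_closure ⟨1, B.mon.one_mem, s, rfl⟩
    have := mul_mem h1 h2
    rwa [← Localization.mk_one_eq_algebraMap, Localization.mk_mul, mul_one, one_mul] at this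

/-- The localization `S⁻¹B` of an ordered blueprint at a multiplicative subset. -/
def OBlpr.loc : OBlpr.{u} :=
  letI := locOrder B S
  { plus := Localization S
    add_le := by
      rintro _ _ _ _ ⟨a, b, s, h, rfl, rfl⟩ ⟨a', b', s', h', rfl, rfl⟩
      exact ⟨_, _, s * s', B.add_le (B.mul_le (le_refl (s : B.plus)) h')
        (B.mul_le (le_refl (s' : B.plus)) h), Localization.add_mk _ _ _ _,
        Localization.add_mk _ _ _ _⟩
    mul_le := by
      rintro _ _ _ _ ⟨a, b, s, h, rfl, rfl⟩ ⟨a', b', s', h', rfl, rfl⟩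
      exact ⟨_, _, s * s', B.mul_le h h', Localization.mk_mul _ _ _ _,
        Localization.mk_mul _ _ _ _⟩
    mon := locMon B S
    zero_mem := ⟨0, B.zero_mem, 1, (Localization.mk_zero _).symm⟩
    generates := locMon_generates B S }

variable {B S}

/-- The fraction `a / s`. -/
def OBlpr.frac (a : B.plus) (s : S) : (B.loc S).plus := Localization.mk a s

theorem frac_eq_frac {a b : B.plus} {s t : S} :
    (OBlpr.frac a s = OBlpr.frac b t) ↔ ∃ u : S, (u : B.plus) * (t * a) = u * (s * b) := by
  exact Localization.mk_eq_mk_iff.trans Localization.r_iff_exists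

theorem frac_mul_frac (a b : B.plus) (s t : S) :
    OBlpr.frac a s * OBlpr.frac b t = OBlpr.frac (a * b) (s * t) :=
  Localization.mk_mul _ _ _ _

theorem frac_one : OBlpr.frac (1 : B.plus) (1 : S) = 1 := Localization.mk_one

theorem frac_zero (s : S) : OBlpr.frac (0 : B.plus) s = 0 := Localization.mk_zero _

theorem frac_mul_swap (a b : S) : OBlpr.frac (a : B.plus) b * OBlpr.frac (b : B.plus) a = 1 := by
  rw [frac_mul_frac, ← frac_one, frac_eq_frac]
  exact ⟨1, by push_cast; ring⟩

theorem frac_surjective (x : (B.loc S).plus) : ∃ a s, x = OBlpr.frac (S := S) a s := by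
  induction x using Localization.induction_on with
  | H x => exact ⟨x.1, x.2, rfl⟩

theorem frac_le {x y : (B.loc S).plus} :
    x ≤ y ↔ ∃ (a b : B.plus) (s : S), a ≤ b ∧ x = OBlpr.frac a s ∧ y = OBlpr.frac b s := Iff.rfl

theorem mem_loc_mon {x : (B.loc S).plus} :
    x ∈ (B.loc S).mon ↔ ∃ a ∈ B.mon, ∃ s : S, x = OBlpr.frac a s := Iff.rfl

/-- The canonical morphism `B → S⁻¹B`. -/
def OBlpr.toLoc (B : OBlpr.{u}) (S : Submonoid B.plus) : Hom B (B.loc S) where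
  toRingHom := algebraMap B.plus (Localization S)
  mono {x y} h := ⟨x, y, 1, h, (Localization.mk_one_eq_algebraMap _).symm,
    (Localization.mk_one_eq_algebraMap _).symm⟩
  map_mon {a} h := ⟨a, h, 1, (Localization.mk_one_eq_algebraMap _).symm⟩

theorem toLoc_apply (B : OBlpr.{u}) (S : Submonoid B.plus) (a : B.plus) :
    (B.toLoc S).toRingHom a = OBlpr.frac a 1 := (Localization.mk_one_eq_algebraMap a).symm

/-- The semiring homomorphism underlying `OBlpr.locLift`. -/
def locLiftHom {C : OBlpr.{v}} (f : Hom B C) (hf : ∀ s ∈ S, C.IsUnitElt (f.toRingHom s)) :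
    Localization S →+* C.plus :=
  IsLocalization.lift (M := S) (g := f.toRingHom) (fun s => by
    obtain ⟨_, b, _, h⟩ := hf s s.2
    exact IsUnit.of_mul_eq_one b h)

theorem locLiftHom_mk {C : OBlpr.{v}} (f : Hom B C)
    (hf : ∀ s ∈ S, C.IsUnitElt (f.toRingHom s)) (a : B.plus) (s : S) {c : C.plus}
    (hc : f.toRingHom s * c = 1) :
    locLiftHom f hf (Localization.mk a s) = f.toRingHom a * c := by
  rw [locLiftHom, Localization.mk_eq_mk', IsLocalization.lift_mk'_spec, mul_left_comm, hc, mul_one]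

/-- The universal property of the localization, for a morphism that sends `S` to units. -/
def OBlpr.locLift {C : OBlpr.{v}} (f : Hom B C) (hf : ∀ s ∈ S, C.IsUnitElt (f.toRingHom s)) :
    Hom (B.loc S) C where
  toRingHom := locLiftHom f hf
  mono := by
    rintro _ _ ⟨a, b, s, h, rfl, rfl⟩
    obtain ⟨_, c, _, hc⟩ := hf s s.2
    have h1 := locLiftHom_mk f hf a s hc
    have h2 := locLiftHom_mk f hf b s hc
    exact h1.le.trans ((C.mul_le (f.mono h) le_rfl).trans h2.ge)
  map_mon := by
    rintro _ ⟨a, ha, s, rfl⟩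
    obtain ⟨_, c, hc', hc⟩ := hf s s.2
    have h1 := locLiftHom_mk f hf a s hc
    exact h1 ▸ C.mon.mul_mem (f.map_mon ha) hc'

theorem locLift_frac {C : OBlpr.{v}} (f : Hom B C)
    (hf : ∀ s ∈ S, C.IsUnitElt (f.toRingHom s)) (a : B.plus) (s : S) :
    f.toRingHom s * (OBlpr.locLift f hf).toRingHom (OBlpr.frac a s) = f.toRingHom a := by
  obtain ⟨_, c, _, hc⟩ := hf s s.2
  have : (OBlpr.locLift f hf).toRingHom (OBlpr.frac a s) = f.toRingHom a * c :=
    locLiftHom_mk f hf a s hc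
  rw [this, mul_left_comm, hc, mul_one]

end Localization

/-! ### Prime `m`-ideals and spectra -/

/-- A prime `m`-ideal of `B`: a subset `I` of `B^•` with `0 ∈ I` and `I B = I` whose complement is
a multiplicative subset. -/
@[ext]
structure MPrime (B : OBlpr.{u}) where
  carrier : Set B.plus
  subset : carrier ⊆ B.mon
  zero_mem : 0 ∈ carrier
  mul_mem : ∀ {a b}, a ∈ carrier → b ∈ B.mon → a * b ∈ carrier
  one_notMem : 1 ∉ carrier
  mul_notMem : ∀ {a b}, a ∈ B.mon → b ∈ B.mon → a ∉ carrier → b ∉ carrier → a * b ∉ carrier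

/-- The complement of a prime `m`-ideal in `B^•`. -/
def MPrime.compl {B : OBlpr.{u}} (p : MPrime B) : Submonoid B.plus where
  carrier := {s | s ∈ B.mon ∧ s ∉ p.carrier}
  one_mem' := ⟨B.mon.one_mem, p.one_notMem⟩
  mul_mem' h h' := ⟨B.mon.mul_mem h.1 h'.1, p.mul_notMem h.1 h'.1 h.2 h'.2⟩

/-- The inverse image of a prime `m`-ideal. -/
def MPrime.comap {B : OBlpr.{u}} {C : OBlpr.{v}} (f : Hom B C) (p : MPrime C) : MPrime B where
  carrier := {a | a ∈ B.mon ∧ f.toRingHom a ∈ p.carrier}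
  subset _ h := h.1
  zero_mem := ⟨B.zero_mem, by rw [map_zero]; exact p.zero_mem⟩
  mul_mem h hb := ⟨B.mon.mul_mem h.1 hb, by rw [map_mul]; exact p.mul_mem h.2 (f.map_mon hb)⟩
  one_notMem h := p.one_notMem (by rw [← map_one f.toRingHom]; exact h.2)
  mul_notMem ha hb h h' hab := p.mul_notMem (f.map_mon ha) (f.map_mon hb)
    (fun k => h ⟨ha, k⟩) (fun k => h' ⟨hb, k⟩) (by rw [← map_mul]; exact hab.2)

/-- The topology generated by the principal opens `U_h = {p | h ∉ p}`, for `h` in `B^•`. -/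
instance specTop (B : OBlpr.{u}) : TopologicalSpace (MPrime B) :=
  TopologicalSpace.generateFrom {U | ∃ h ∈ B.mon, U = {p | h ∉ p.carrier}}

/-- The principal open `U_h`. -/
def specOpen (B : OBlpr.{u}) (h : B.plus) (hh : h ∈ B.mon) : Opens (MPrime B) :=
  ⟨{p | h ∉ p.carrier}, TopologicalSpace.isOpen_generateFrom_of_mem ⟨h, hh, rfl⟩⟩

/-- The structure sheaf of `Spec B`: the sections are the functions with values in the
localizations `B_p` that are locally represented by fractions `a / h`. -/
def specData (B : OBlpr.{u}) : FracData (MPrime B) where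
  A p := B.loc p.compl
  ι := B.mon × B.mon
  rep i p z := ∃ h : (i.2 : B.plus) ∉ p.carrier, z = OBlpr.frac (S := p.compl) (i.1 : B.plus) ⟨i.2, i.2.2, h⟩
  rep_mon := by
    rintro i x z ⟨h, rfl⟩
    exact ⟨i.1, i.1.2, _, rfl⟩
  rep_zero := ⟨(⟨0, B.zero_mem⟩, 1), fun p => ⟨p.one_notMem, (frac_zero _).symm⟩⟩
  rep_one := ⟨(1, 1), fun p => ⟨p.one_notMem, frac_one.symm⟩⟩
  rep_mul i j := ⟨(i.1 * j.1, i.2 * j.2), by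
    rintro p _ _ ⟨h, rfl⟩ ⟨h', rfl⟩
    exact ⟨p.mul_notMem i.2.2 j.2.2 h h', frac_mul_frac _ _ _ _⟩⟩

/-- The spectrum of an ordered blueprint. -/
def Spec (B : OBlpr.{u}) : OBSpace.{u} := (specData B).space

theorem frac_mul_ne_one {B : OBlpr.{u}} (p : MPrime B) {a : B.plus} (ha : a ∈ p.carrier)
    (s : p.compl) {z : (B.loc p.compl).plus} (hz : z ∈ (B.loc p.compl).mon) :
    OBlpr.frac a s * z ≠ 1 := by
  obtain ⟨b, hb, t, rfl⟩ := mem_loc_mon.1 hz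
  rw [frac_mul_frac, ← frac_one, ne_eq, frac_eq_frac]
  rintro ⟨u, hu⟩
  have h1 : (u : B.plus) * (((s * t : p.compl) : B.plus) * 1) ∉ p.carrier := by
    rw [mul_one]; exact (u * (s * t)).2.2
  refine h1 ?_
  rw [← hu]
  have h2 := p.mul_mem (p.mul_mem ha hb) u.2.1
  have : (u : B.plus) * (((1 : p.compl) : B.plus) * (a * b)) = a * b * u := by
    push_cast; ring
  rwa [this]

/-- The map `B_{f⁻¹(p)} → C_p` induced by `f : B → C`. -/
def stalkMap {B : OBlpr.{u}} {C : OBlpr.{v}} (f : Hom B C) (p : MPrime C) :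
    Hom (B.loc (p.comap f).compl) (C.loc p.compl) :=
  OBlpr.locLift (f.comp (C.toLoc p.compl)) (by
    rintro s ⟨hs, hs'⟩
    have h : f.toRingHom s ∉ p.carrier := fun h => hs' ⟨hs, h⟩
    refine ⟨(f.comp (C.toLoc p.compl)).map_mon hs,
      OBlpr.frac 1 ⟨f.toRingHom s, f.map_mon hs, h⟩, ⟨1, C.mon.one_mem, _, rfl⟩, ?_⟩
    have : (f.comp (C.toLoc p.compl)).toRingHom s = OBlpr.frac (f.toRingHom s) 1 :=
      toLoc_apply _ _ _
    rw [this, frac_mul_frac, ← frac_one, frac_eq_frac]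
    exact ⟨1, by push_cast; ring⟩)

theorem stalkMap_frac {B : OBlpr.{u}} {C : OBlpr.{v}} (f : Hom B C) (p : MPrime C) (a : B.plus)
    (s : (p.comap f).compl) :
    (stalkMap f p).toRingHom (OBlpr.frac a s) =
      OBlpr.frac (S := p.compl) (f.toRingHom a) ⟨f.toRingHom s, f.map_mon s.2.1, fun h => s.2.2 ⟨s.2.1, h⟩⟩ := by
  set t : p.compl := ⟨f.toRingHom s, f.map_mon s.2.1, fun h => s.2.2 ⟨s.2.1, h⟩⟩ with ht
  have h1 : (C.toLoc p.compl).toRingHom (f.toRingHom s) *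
      (stalkMap f p).toRingHom (OBlpr.frac a s) = (C.toLoc p.compl).toRingHom (f.toRingHom a) :=
    locLift_frac (f.comp (C.toLoc p.compl)) _ a s
  rw [toLoc_apply, toLoc_apply] at h1
  have h2 : OBlpr.frac (S := p.compl) (1 : C.plus) t * OBlpr.frac (t : C.plus) 1 = 1 := by
    rw [frac_mul_frac, ← frac_one, frac_eq_frac]
    exact ⟨1, by push_cast; ring⟩
  have h3 := congrArg (fun z => OBlpr.frac (S := p.compl) (1 : C.plus) t * z) h1
  beta_reduce at h3
  have ht' : f.toRingHom s = (t : C.plus) := rfl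
  rw [ht', ← mul_assoc, h2, one_mul, frac_mul_frac, one_mul, mul_one] at h3
  exact h3

theorem specMap_continuous {B : OBlpr.{u}} {C : OBlpr.{v}} (f : Hom B C) :
    Continuous (MPrime.comap f) := by
  refine continuous_generateFrom_iff.2 ?_
  rintro _ ⟨h, hh, rfl⟩
  have : MPrime.comap f ⁻¹' {p | h ∉ p.carrier} = {p | f.toRingHom h ∉ p.carrier} := by
    ext p
    exact ⟨fun k k' => k ⟨hh, k'⟩, fun k k' => k k'.2⟩
  rw [this]
  exact (specOpen C _ (f.map_mon hh)).2

/-- A section of `Spec B` whose value at `p` is a fraction that is a unit is a unit near `p`. -/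
theorem spec_isUnitAt {B : OBlpr.{u}} {V : Opens (MPrime B)}
    {s : ((specData B).sections V).plus} (hs : s ∈ ((specData B).sections V).mon) {p : MPrime B}
    (hp : p ∈ V)
    (h : ∀ a ∈ p.carrier, ∀ t : p.compl, ((specData B).eval p hp).toRingHom s ≠ OBlpr.frac a t) :
    (Spec B).IsUnitAt (U := V) s p := by
  obtain ⟨W, hW, i, hi⟩ := (specData B).mem_sections_mon.1 hs p hp
  obtain ⟨h1, h2⟩ := hi p hp hW
  have h3 : (i.1 : B.plus) ∉ p.carrier := fun h' => h _ h' _ h2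
  let V' : Opens (MPrime B) := V ⊓ (W ⊓ specOpen B i.1 i.1.2)
  refine (specData B).isUnitAt_of hs (V' := V') inf_le_left ⟨hp, hW, h3⟩
    (fun x hx => OBlpr.frac (S := x.compl) (i.2 : B.plus) ⟨i.1, i.1.2, hx.2.2⟩) (i.2, i.1) ?_ ?_
  · exact fun x hx => ⟨hx.2.2, rfl⟩
  · intro x hx
    obtain ⟨h4, h5⟩ := hi x hx.1 hx.2.1
    exact (congrArg (fun z => z * OBlpr.frac (S := x.compl) (i.2 : B.plus) ⟨i.1, i.1.2, hx.2.2⟩)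
      h5).trans (frac_mul_swap (S := x.compl) ⟨i.1, i.1.2, hx.2.2⟩ ⟨i.2, i.2.2, h4⟩)

/-- The map of sections induced by a morphism `B → C`. -/
def Spec.mapApp {B : OBlpr.{u}} {C : OBlpr.{v}} (f : Hom B C) (V : Opens (MPrime B))
    (U : Opens (MPrime C)) (h : ∀ p ∈ U, p.comap f ∈ V) :
    Hom ((specData B).sections V) ((specData C).sections U) :=
  (specData C).toSections
    (fun p hp => ((specData B).eval (p.comap f) (h p hp)).comp (stalkMap f p)) (by
      intro s hs x
      obtain ⟨W, hW, i, hi⟩ := (specData B).mem_sections_mon.1 hs _ (h x.1 x.2)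
      refine ⟨Opens.comap ⟨MPrime.comap f, specMap_continuous f⟩ W, hW,
        (⟨_, f.map_mon i.1.2⟩, ⟨_, f.map_mon i.2.2⟩), fun y hy => ?_⟩
      obtain ⟨h1, h2⟩ := hi _ (h y.1 y.2) hy
      refine ⟨fun h' => h1 ⟨i.2.2, h'⟩, ?_⟩
      exact (congrArg (stalkMap f y.1).toRingHom h2).trans (stalkMap_frac f y.1 _ _))

theorem Spec.mapApp_isUnitAt {B : OBlpr.{u}} {C : OBlpr.{v}} (f : Hom B C) {V : Opens (MPrime B)}
    {U : Opens (MPrime C)} (h : ∀ p ∈ U, p.comap f ∈ V) {s : ((specData B).sections V).plus}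
    (hs : s ∈ ((specData B).sections V).mon) {p : MPrime C} (hp : p ∈ U)
    (hu : (specData C).space.IsUnitAt ((Spec.mapApp f V U h).toRingHom s) p) :
    (Spec B).IsUnitAt (U := V) s (p.comap f) := by
  refine spec_isUnitAt hs (h p hp) ?_
  intro a ha k hk
  obtain ⟨t, ht, h1⟩ := (specData C).eval_of_isUnitAt hu hp
  have h2 : ((specData C).eval p hp).toRingHom ((Spec.mapApp f V U h).toRingHom s) =
      (stalkMap f p).toRingHom (((specData B).eval _ (h p hp)).toRingHom s) := rfl
  have h3 := (h2.trans (congrArg (stalkMap f p).toRingHom hk)).trans (stalkMap_frac f p a k)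
  exact frac_mul_ne_one p ha.2 _ ht ((congrArg (fun z => z * t) h3).symm.trans h1)

/-- The morphism `Spec C → Spec B` induced by a morphism `B → C`. -/
def Spec.map {B : OBlpr.{u}} {C : OBlpr.{v}} (f : Hom B C) : (Spec C).Hom (Spec B) where
  base := MPrime.comap f
  cont := specMap_continuous f
  app V U h := Spec.mapApp f V U h
  natural hV hU h h' s := rfl
  isLocal V U h s hs p hp hu := Spec.mapApp_isUnitAt f h hs hp hu

/-! ### Projective spectra of graded ordered blueprints -/

/-- A graded ordered blueprint: `B^•` is the union of subsets `B_i` that meet pairwise in `{0}` and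
satisfy `B_i B_j ⊆ B_{i+j}`. -/
structure GrOBlpr extends OBlpr.{u} where
  part : ℕ → Set plus
  part_subset : ∀ i, part i ⊆ mon
  cover : ∀ a ∈ mon, ∃ i, a ∈ part i
  zero_mem_part : ∀ i, 0 ∈ part i
  one_mem_part : 1 ∈ part 0
  eq_zero : ∀ {i j a}, i ≠ j → a ∈ part i → a ∈ part j → a = 0
  mul_mem_part : ∀ {i j a b}, a ∈ part i → b ∈ part j → a * b ∈ part (i + j)

/-- A point of `Proj C`: a relevant homogeneous prime `m`-ideal, i.e. one that does not contain all
elements of positive degree. (As every element of `C^•` is homogeneous, every prime `m`-ideal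
is homogeneous.) -/
@[ext]
structure ProjPt (C : GrOBlpr.{u}) extends MPrime C.toOBlpr where
  relevant : ∃ i, 0 < i ∧ ∃ a ∈ C.part i, a ∉ carrier

/-- The topology generated by the principal opens `U_h = {p | h ∉ p}`. -/
instance projTop (C : GrOBlpr.{u}) : TopologicalSpace (ProjPt C) :=
  TopologicalSpace.generateFrom {U | ∃ h ∈ C.mon, U = {p | h ∉ p.carrier}}

/-- The principal open `U_h`. -/
def projOpen (C : GrOBlpr.{u}) (h : C.plus) (hh : h ∈ C.mon) : Opens (ProjPt C) :=
  ⟨{p | h ∉ p.carrier}, TopologicalSpace.isOpen_generateFrom_of_mem ⟨h, hh, rfl⟩⟩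

/-- The localization of `C` at the complement of `p`. -/
abbrev ProjPt.fullLoc {C : GrOBlpr.{u}} (p : ProjPt C) : OBlpr.{u} := C.loc p.toMPrime.compl

/-- The fractions `a / h` of degree zero in the localization of `C` at `p`. -/
def ProjPt.degZero {C : GrOBlpr.{u}} (p : ProjPt C) : Submonoid p.fullLoc.plus where
  carrier := {z | ∃ i, ∃ a ∈ C.part i, ∃ h : p.toMPrime.compl, (h : C.plus) ∈ C.part i ∧
    z = OBlpr.frac a h}
  one_mem' := ⟨0, 1, C.one_mem_part, 1, C.one_mem_part, frac_one.symm⟩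
  mul_mem' := by
    rintro _ _ ⟨i, a, ha, h, hh, rfl⟩ ⟨j, b, hb, k, hk, rfl⟩
    exact ⟨i + j, a * b, C.mul_mem_part ha hb, h * k, C.mul_mem_part hh hk, frac_mul_frac _ _ _ _⟩

/-- The blueprint `C_(p)` of elements of degree zero in the localization of `C` at `p`. -/
def ProjPt.loc {C : GrOBlpr.{u}} (p : ProjPt C) : OBlpr.{u} :=
  OBlpr.sub p.fullLoc p.degZero
    ⟨0, 0, C.zero_mem_part 0, 1, C.one_mem_part, (frac_zero _).symm⟩

/-- The inclusion of `C_(p)` into the localization of `C` at `p`. -/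
def ProjPt.incl {C : GrOBlpr.{u}} (p : ProjPt C) : Hom p.loc p.fullLoc where
  toRingHom := (Subsemiring.closure (p.degZero : Set p.fullLoc.plus)).subtype
  mono h := h
  map_mon := by
    rintro a ⟨i, b, hb, h, _, hab⟩
    exact mem_loc_mon.2 ⟨b, C.part_subset _ hb, h, hab⟩

theorem ProjPt.incl_injective {C : GrOBlpr.{u}} (p : ProjPt C) :
    Function.Injective p.incl.toRingHom := Subtype.val_injective

theorem ProjPt.mem_mon {C : GrOBlpr.{u}} (p : ProjPt C) {z : p.loc.plus} :
    z ∈ p.loc.mon ↔ ∃ i, ∃ a ∈ C.part i, ∃ h : p.toMPrime.compl, (h : C.plus) ∈ C.part i ∧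
      p.incl.toRingHom z = OBlpr.frac a h := Iff.rfl

/-- The fraction `a / h` of degree zero. -/
def ProjPt.frac {C : GrOBlpr.{u}} (p : ProjPt C) {i : ℕ} (a : C.part i) (h : C.part i)
    (hh : (h : C.plus) ∉ p.carrier) : p.loc.plus :=
  ⟨OBlpr.frac (S := p.toMPrime.compl) (a : C.plus) ⟨h, C.part_subset _ h.2, hh⟩,
    Subsemiring.subset_closure ⟨i, a, a.2, _, h.2, rfl⟩⟩

theorem ProjPt.incl_frac {C : GrOBlpr.{u}} (p : ProjPt C) {i : ℕ} (a : C.part i) (h : C.part i)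
    (hh : (h : C.plus) ∉ p.carrier) : p.incl.toRingHom (p.frac a h hh) =
      OBlpr.frac (S := p.toMPrime.compl) (a : C.plus) ⟨h, C.part_subset _ h.2, hh⟩ := rfl

theorem ProjPt.frac_mem {C : GrOBlpr.{u}} (p : ProjPt C) {i : ℕ} (a : C.part i) (h : C.part i)
    (hh : (h : C.plus) ∉ p.carrier) : p.frac a h hh ∈ p.loc.mon := ⟨i, a, a.2, _, h.2, rfl⟩

theorem ProjPt.exists_frac {C : GrOBlpr.{u}} (p : ProjPt C) {z : p.loc.plus}
    (hz : z ∈ p.loc.mon) : ∃ (i : ℕ) (a h : C.part i) (hh : (h : C.plus) ∉ p.carrier),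
      z = p.frac a h hh := by
  obtain ⟨i, a, ha, h, hh, hz⟩ := p.mem_mon.1 hz
  exact ⟨i, ⟨a, ha⟩, ⟨h, hh⟩, h.2.2, p.incl_injective hz⟩

theorem ProjPt.frac_swap {C : GrOBlpr.{u}} (p : ProjPt C) {i : ℕ} (a h : C.part i)
    (ha : (a : C.plus) ∉ p.carrier) (hh : (h : C.plus) ∉ p.carrier) :
    p.frac a h hh * p.frac h a ha = 1 := by
  refine p.incl_injective ?_
  rw [map_mul, map_one]
  exact frac_mul_swap (S := p.toMPrime.compl) ⟨a, C.part_subset _ a.2, ha⟩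
    ⟨h, C.part_subset _ h.2, hh⟩

theorem ProjPt.frac_not_isUnit {C : GrOBlpr.{u}} (p : ProjPt C) {i : ℕ} (a h : C.part i)
    (ha : (a : C.plus) ∈ p.carrier) (hh : (h : C.plus) ∉ p.carrier) :
    ¬ p.loc.IsUnitElt (p.frac a h hh) := by
  rintro ⟨_, z, hz, h1⟩
  have h2 := congrArg p.incl.toRingHom h1
  rw [map_mul, map_one] at h2
  exact frac_mul_ne_one p.toMPrime ha _ (p.incl.map_mon hz) h2

/-- The structure sheaf of `Proj C`: the sections are the functions with values in the `C_(p)` that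
are locally represented by fractions `a / h` with `a` and `h` of the same degree. -/
def projData (C : GrOBlpr.{u}) : FracData (ProjPt C) where
  A p := p.loc
  ι := Σ i, C.part i × C.part i
  rep i p z := ∃ h : (i.2.2 : C.plus) ∉ p.carrier, z = p.frac i.2.1 i.2.2 h
  rep_mon := by
    rintro i p _ ⟨h, rfl⟩
    exact p.frac_mem _ _ _
  rep_zero := ⟨⟨0, ⟨0, C.zero_mem_part 0⟩, ⟨1, C.one_mem_part⟩⟩, fun p =>
    ⟨p.one_notMem, p.incl_injective (by rw [map_zero, p.incl_frac]; exact (frac_zero _).symm)⟩⟩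
  rep_one := ⟨⟨0, ⟨1, C.one_mem_part⟩, ⟨1, C.one_mem_part⟩⟩, fun p =>
    ⟨p.one_notMem, (p.incl_injective (by rw [map_one, p.incl_frac]; exact frac_one)).symm⟩⟩
  rep_mul i j := ⟨⟨i.1 + j.1, ⟨i.2.1 * j.2.1, C.mul_mem_part i.2.1.2 j.2.1.2⟩,
      ⟨i.2.2 * j.2.2, C.mul_mem_part i.2.2.2 j.2.2.2⟩⟩, by
    rintro p _ _ ⟨h, rfl⟩ ⟨h', rfl⟩
    refine ⟨p.mul_notMem (C.part_subset _ i.2.2.2) (C.part_subset _ j.2.2.2) h h',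
      p.incl_injective ?_⟩
    rw [map_mul]
    exact frac_mul_frac _ _ _ _⟩

/-- The projective spectrum of a graded ordered blueprint. -/
def Proj (C : GrOBlpr.{u}) : OBSpace.{u} := (projData C).space

/-- The map of sections of `pointMor`. -/
def pointApp {C : GrOBlpr.{u}} (x : ProjPt C) {R : OBlpr.{v}} (φ : Hom x.loc R)
    (V : Opens (ProjPt C)) (U : Opens (MPrime R)) (h : ∀ q ∈ U, x ∈ V) :
    Hom ((projData C).sections V) ((specData R).sections U) :=
  (specData R).toSections
    (fun q hq => (((projData C).eval x (h q hq)).comp φ).comp (R.toLoc q.compl)) (by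
      intro s hs q
      refine ⟨U, q.2, (⟨_, (((projData C).eval x (h q.1 q.2)).comp φ).map_mon hs⟩, 1),
        fun y hy => ⟨y.1.one_notMem, ?_⟩⟩
      exact toLoc_apply _ _ _)

/-- The morphism `Spec R → Proj C` with image `x` that is given by a morphism `φ : C_(x) → R` which
maps all non-units to `0`. It is the composition of the morphism `Spec k(x) → Proj C` with
the morphism of spectra induced by `φ`, which factors through the residue field `k(x)`. -/
def pointMor {C : GrOBlpr.{u}} (x : ProjPt C) {R : OBlpr.{v}} (φ : Hom x.loc R)
    (hφ : ∀ z ∈ x.loc.mon, ¬ x.loc.IsUnitElt z → φ.toRingHom z = 0) :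
    (Spec R).Hom (Proj C) where
  base _ := x
  cont := continuous_const
  app V U h := pointApp x φ V U h
  natural _ _ _ _ _ := rfl
  isLocal V U h s hs q hq hu := by
    obtain ⟨t, ht, h1⟩ := (specData R).eval_of_isUnitAt hu hq
    obtain ⟨W, hW, i, hi⟩ := (projData C).mem_sections_mon.1 hs x (h q hq)
    obtain ⟨h2, h3⟩ := hi x (h q hq) hW
    have h4 : (i.2.1 : C.plus) ∉ x.carrier := by
      intro h4
      have h5 := hφ _ (x.frac_mem _ _ h2) (x.frac_not_isUnit _ _ h4 h2)
      have h6 : ((specData R).eval q hq).toRingHom ((pointApp x φ V U h).toRingHom s) =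
          OBlpr.frac (0 : R.plus) (1 : q.compl) :=
        (congrArg (fun z => (R.toLoc q.compl).toRingHom (φ.toRingHom z)) h3).trans
          ((congrArg (R.toLoc q.compl).toRingHom h5).trans (toLoc_apply _ _ _))
      exact frac_mul_ne_one q q.zero_mem _ ht ((congrArg (fun z => z * t) h6).symm.trans h1)
    refine (projData C).isUnitAt_of hs
      (V' := V ⊓ (W ⊓ projOpen C i.2.1 (C.part_subset _ i.2.1.2))) inf_le_left
      ⟨h q hq, hW, h4⟩ (fun y hy => y.frac i.2.2 i.2.1 hy.2.2) ⟨i.1, i.2.2, i.2.1⟩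
      (fun y hy => ⟨hy.2.2, rfl⟩) (fun y hy => ?_)
    obtain ⟨h5, h6⟩ := hi y hy.1 hy.2.1
    exact (congrArg (fun z => z * y.frac i.2.2 i.2.1 hy.2.2) h6).trans (y.frac_swap _ _ hy.2.2 h5)

/-! ### Plücker relations and matroids over pastures -/

/-- The `r`-element subsets of `E`. -/
abbrev RSubset (r : ℕ) (E : Type u) : Type u := {I : Finset E // I.card = r}

/-- The extension by `0` of a function on `r`-subsets to all finite subsets. -/
def extendZero {r : ℕ} {E : Type u} {R : Type v} [Zero R] (Δ : RSubset r E → R) (I : Finset E) :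
    R :=
  if h : I.card = r then Δ ⟨I, h⟩ else 0

/-- The Plücker sum `∑ ε ^ k Δ(I - {i_k}) Δ(J ∪ {i_k})` for an `(r+1)`-subset
`I = {i_0 < ... < i_r}` and an `(r-1)`-subset `J`, where `Δ(J ∪ {i_k}) = 0` if `i_k ∈ J`. -/
def pluckerSum {r : ℕ} {E : Type u} [LinearOrder E] {R : Type v} [CommSemiring R] (ε : R)
    (Δ : RSubset r E → R) (I J : Finset E) (hI : I.card = r + 1) : R :=
  ∑ k : Fin (r + 1), ε ^ (k : ℕ) * extendZero Δ (I.erase (I.orderEmbOfFin hI k)) *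
    extendZero Δ (insert (I.orderEmbOfFin hI k) J)

theorem map_pluckerSum {r : ℕ} {E : Type u} [LinearOrder E] {R : Type v} [CommSemiring R]
    {R' : Type w} [CommSemiring R'] (f : R →+* R') (ε : R) (Δ : RSubset r E → R) (I J : Finset E)
    (hI : I.card = r + 1) :
    f (pluckerSum ε Δ I J hI) = pluckerSum (f ε) (fun K => f (Δ K)) I J hI := by
  have h : ∀ K, f (extendZero Δ K) = extendZero (fun K => f (Δ K)) K := by
    intro K
    unfold extendZero
    split_ifs
    · rfl
    · exact map_zero f
  unfold pluckerSum
  simp only [map_sum, map_mul, map_pow, h]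

/-- A Grassmann-Plücker function of rank `r` on `E` with coefficients in the pasture `F`. -/
@[ext]
structure GPFun (F : Pasture.{w}) (r : ℕ) (E : Type u) [LinearOrder E] where
  toFun : RSubset r E → F.plus
  mem : ∀ I, toFun I ∈ F.mon
  exists_unit : ∃ I, F.IsUnitElt (toFun I)
  plucker : ∀ (I J : Finset E) (hI : I.card = r + 1), J.card + 1 = r →
    0 ≤ pluckerSum F.eps toFun I J hI

/-- Two Grassmann-Plücker functions are equivalent if they differ by a factor in `F^×`. -/
instance GPFun.setoid (F : Pasture.{w}) (r : ℕ) (E : Type u) [LinearOrder E] :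
    Setoid (GPFun F r E) where
  r Δ Δ' := ∃ a, F.IsUnitElt a ∧ ∀ I, Δ.toFun I = a * Δ'.toFun I
  iseqv :=
    { refl := fun Δ => ⟨1, F.unitGroup.one_mem, fun I => (one_mul _).symm⟩
      symm := by
        rintro Δ Δ' ⟨a, ⟨ha, b, hb, hab⟩, h⟩
        exact ⟨b, ⟨hb, a, ha, by rw [mul_comm, hab]⟩, fun I => by
          rw [h, ← mul_assoc, mul_comm b a, hab, one_mul]⟩
      trans := by
        rintro Δ Δ' Δ'' ⟨a, ha, h⟩ ⟨b, hb, h'⟩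
        exact ⟨a * b, F.unitGroup.mul_mem ha hb, fun I => by rw [h, h', mul_assoc]⟩ }

/-- The (strong) `F`-matroids of rank `r` on `E`. A matroid is a `𝕂`-matroid for the Krasner
hyperfield `𝕂`. -/
def FMatroid (F : Pasture.{w}) (r : ℕ) (E : Type u) [LinearOrder E] : Type (max u w) :=
  Quotient (GPFun.setoid F r E)

/-- The composition of a Grassmann-Plücker function with a morphism of pastures. -/
def GPFun.map {F : Pasture.{v}} {F' : Pasture.{w}} (g : Hom F.toOBlpr F'.toOBlpr) {r : ℕ}
    {E : Type u} [LinearOrder E] (Δ : GPFun F r E) : GPFun F' r E where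
  toFun I := g.toRingHom (Δ.toFun I)
  mem I := g.map_mon (Δ.mem I)
  exists_unit := by
    obtain ⟨I, hI⟩ := Δ.exists_unit
    exact ⟨I, IsUnitElt.map g hI⟩
  plucker I J hI hJ := by
    have := g.mono (Δ.plucker I J hI hJ)
    rwa [map_zero, map_pluckerSum, g.map_eps F.isPasture.pasteurized F'.isPasture.pasteurized]
      at this

/-- The pushforward of an `F`-matroid along a morphism of pastures. -/
def FMatroid.push {F : Pasture.{v}} {F' : Pasture.{w}} (g : Hom F.toOBlpr F'.toOBlpr) {r : ℕ}
    {E : Type u} [LinearOrder E] : FMatroid F r E → FMatroid F' r E :=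
  Quotient.map (GPFun.map g) (by
    rintro Δ Δ' ⟨a, ha, h⟩
    exact ⟨_, IsUnitElt.map g ha, fun I => (congrArg g.toRingHom (h I)).trans (map_mul _ _ _)⟩)

/-- The underlying matroid of an `F`-matroid. -/
def FMatroid.underlying {F : Pasture.{w}} {r : ℕ} {E : Type u} [LinearOrder E]
    (N : FMatroid F r E) : FMatroid Krasner r E :=
  N.push (terminalMap F)

/-! ### The matroid space -/

/-- The polynomial semiring over `ℕ[{1, ε}]` in variables `x_I`, where `I` is an `r`-subset
of `E`. -/
abbrev PolyRing (r : ℕ) (E : Type u) : Type u :=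
  MvPolynomial (RSubset r E) (MonoidAlgebra ℕ ℤˣ)

/-- The element `ε`. -/
def polyEps (r : ℕ) (E : Type u) : PolyRing r E := MvPolynomial.C (MonoidAlgebra.of ℕ ℤˣ (-1))

/-- The monomials of degree `i` with coefficient `1` or `ε`, together with `0`. -/
def polyPart (r : ℕ) (E : Type u) (i : ℕ) : Set (PolyRing r E) :=
  {a | a = 0 ∨ ∃ (d : RSubset r E →₀ ℕ) (s : ℤˣ), d.degree = i ∧
    a = MvPolynomial.monomial d (MonoidAlgebra.of ℕ ℤˣ s)}

theorem polyPart_mul {r : ℕ} {E : Type u} {i j : ℕ} {a b : PolyRing r E} (ha : a ∈ polyPart r E i)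
    (hb : b ∈ polyPart r E j) : a * b ∈ polyPart r E (i + j) := by
  obtain rfl | ⟨d, s, rfl, rfl⟩ := ha
  · exact Or.inl (zero_mul _)
  obtain rfl | ⟨d', s', rfl, rfl⟩ := hb
  · exact Or.inl (mul_zero _)
  · exact Or.inr ⟨d + d', s * s', map_add _ _ _, by
      rw [MvPolynomial.monomial_mul, ← map_mul]⟩

theorem one_mem_polyPart (r : ℕ) (E : Type u) : 1 ∈ polyPart r E 0 :=
  Or.inr ⟨0, 1, map_zero _, by rw [map_one]; rfl⟩

theorem X_mem_polyPart {r : ℕ} {E : Type u} (I : RSubset r E) :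
    MvPolynomial.X I ∈ polyPart r E 1 :=
  Or.inr ⟨Finsupp.single I 1, 1, by simp, by rw [map_one]; rfl⟩

/-- The multiplicative set of all monomials with coefficient `1` or `ε`, together with `0`. -/
def polyMon (r : ℕ) (E : Type u) : Submonoid (PolyRing r E) where
  carrier := {a | ∃ i, a ∈ polyPart r E i}
  one_mem' := ⟨0, one_mem_polyPart r E⟩
  mul_mem' := by
    rintro a b ⟨i, ha⟩ ⟨j, hb⟩
    exact ⟨i + j, polyPart_mul ha hb⟩

theorem polyMon_generates (r : ℕ) (E : Type u) :
    Subsemiring.closure (polyMon r E : Set (PolyRing r E)) = ⊤ := by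
  rw [eq_top_iff]
  intro p _
  induction p using MvPolynomial.induction_on with
  | C a =>
    induction a using MonoidAlgebra.induction_on with
    | of s => exact Subsemiring.subset_closure ⟨0, Or.inr ⟨0, s, map_zero _, rfl⟩⟩
    | add f g hf hg => rw [map_add]; exact add_mem (hf trivial) (hg trivial)
    | smul n f hf => rw [map_nsmul]; exact Subsemiring.nsmul_mem _ (hf trivial) n
  | add p q hp hq => exact add_mem (hp trivial) (hq trivial)
  | mul_X p I hp =>
    exact mul_mem (hp trivial) (Subsemiring.subset_closure ⟨1, X_mem_polyPart I⟩)

/-- The relation `0 ≤ 1 + ε` and the Plücker relations. -/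
def matRel (r : ℕ) (E : Type u) [LinearOrder E] (x y : PolyRing r E) : Prop :=
  x = 0 ∧ (y = 1 + polyEps r E ∨ ∃ (I J : Finset E) (hI : I.card = r + 1), J.card + 1 = r ∧
    y = pluckerSum (polyEps r E) MvPolynomial.X I J hI)

/-- The homomorphism to `ℕ` that sends every monomial of degree `i` to `2 ^ i`. -/
def degHom (r : ℕ) (E : Type u) : PolyRing r E →+* ℕ :=
  MvPolynomial.eval₂Hom (termCount ℤˣ) (fun _ => 2)

theorem degHom_monomial {r : ℕ} {E : Type u} (d : RSubset r E →₀ ℕ) (s : ℤˣ) :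
    degHom r E (MvPolynomial.monomial d (MonoidAlgebra.of ℕ ℤˣ s)) = 2 ^ d.degree := by
  rw [degHom, MvPolynomial.coe_eval₂Hom, MvPolynomial.eval₂_monomial, termCount_of, one_mul,
    Finsupp.prod, Finset.prod_pow_eq_pow_sum]
  rfl

theorem degHom_le {r : ℕ} {E : Type u} [LinearOrder E] {x y : PolyRing r E}
    (h : GenLE (matRel r E) x y) : degHom r E x ≤ degHom r E y := by
  induction h with
  | of h => rw [h.1, map_zero]; exact Nat.zero_le _
  | refl x => exact le_rfl
  | trans _ _ h h' => exact h.trans h'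
  | add _ _ h h' => rw [map_add, map_add]; exact add_le_add h h'
  | mul _ _ h h' => rw [map_mul, map_mul]; exact Nat.mul_le_mul h h'

/-- The graded ordered blueprint `F₁^±[x_I] // Pl(r, E)`. -/
def matAlg (r : ℕ) (E : Type u) [LinearOrder E] : GrOBlpr.{u} where
  toOBlpr := pres (matRel r E) (polyMon r E) ⟨0, Or.inl rfl⟩ (polyMon_generates r E)
  part i := (genCon (matRel r E)).mk' '' polyPart r E i
  part_subset i := by
    rintro _ ⟨a, ha, rfl⟩
    exact ⟨a, ⟨i, ha⟩, rfl⟩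
  cover := by
    rintro _ ⟨a, ⟨i, ha⟩, rfl⟩
    exact ⟨i, a, ha, rfl⟩
  zero_mem_part i := ⟨0, Or.inl rfl, map_zero _⟩
  one_mem_part := ⟨1, one_mem_polyPart r E, map_one _⟩
  eq_zero := by
    rintro i j _ hij ⟨a, ha, rfl⟩ ⟨b, hb, hab⟩
    obtain rfl | ⟨d, s, rfl, rfl⟩ := ha
    · exact map_zero _
    obtain rfl | ⟨d', s', rfl, rfl⟩ := hb
    · exact hab.symm.trans (map_zero _)
    · obtain ⟨h1, h2⟩ := (genCon_mk_eq _).1 hab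
      have h3 := le_antisymm (degHom_le h1) (degHom_le h2)
      rw [degHom_monomial, degHom_monomial] at h3
      exact absurd (Nat.pow_right_injective le_rfl h3).symm hij
  mul_mem_part := by
    rintro i j _ _ ⟨a, ha, rfl⟩ ⟨b, hb, rfl⟩
    exact ⟨a * b, polyPart_mul ha hb, map_mul _ _ _⟩

/-- The quotient map from polynomials. -/
def matMk (r : ℕ) (E : Type u) [LinearOrder E] : PolyRing r E →+* (matAlg r E).plus :=
  (genCon (matRel r E)).mk'

theorem mem_matAlg_part {r : ℕ} {E : Type u} [LinearOrder E] {i : ℕ} {a : (matAlg r E).plus} :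
    a ∈ (matAlg r E).part i ↔ ∃ p ∈ polyPart r E i, matMk r E p = a := Iff.rfl

/-- The matroid space of rank `r` on `E`. -/
def Mat (r : ℕ) (E : Type u) [LinearOrder E] : OBSpace.{u} := Proj (matAlg r E)

/-! ### The characteristic morphism -/

/-- The homomorphism `ℕ[{1, ε}] → F^+` that sends `ε` to the weak inverse of `1` in `F`. -/
def signHom (F : Pasture.{w}) : MonoidAlgebra ℕ ℤˣ →+* F.plus :=
  (MonoidAlgebra.lift ℕ F.plus ℤˣ
    { toFun := fun s => if s = 1 then 1 else F.eps
      map_one' := if_pos rfl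
      map_mul' := by
        have h : (-1 : ℤˣ) ≠ 1 := by decide
        intro s t
        rcases Int.units_eq_one_or s with rfl | rfl <;> rcases Int.units_eq_one_or t with rfl | rfl
        · simp
        · simp
        · simp
        · simp [h, F.isPasture.pasteurized.eps_mul_eps] }).toRingHom

theorem signHom_of (F : Pasture.{w}) (s : ℤˣ) :
    signHom F (MonoidAlgebra.of ℕ ℤˣ s) = if s = 1 then 1 else F.eps := by
  simp [signHom]

theorem signHom_mem (F : Pasture.{w}) (s : ℤˣ) :
    signHom F (MonoidAlgebra.of ℕ ℤˣ s) ∈ F.mon := by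
  rw [signHom_of]
  split_ifs
  · exact F.mon.one_mem
  · exact F.isPasture.pasteurized.eps_spec.1

theorem signHom_neg_one (F : Pasture.{w}) :
    signHom F (MonoidAlgebra.of ℕ ℤˣ (-1)) = F.eps := by
  rw [signHom_of, if_neg (by decide)]

section CharMor

variable {F : Pasture.{w}} {r : ℕ} {E : Type u} [LinearOrder E] (Δ : GPFun F r E)

/-- The evaluation `x_I ↦ Δ(I)` on polynomials. -/
def GPFun.polyEval : PolyRing r E →+* F.plus := MvPolynomial.eval₂Hom (signHom F) Δ.toFun

theorem GPFun.polyEval_monomial (d : RSubset r E →₀ ℕ) (s : ℤˣ) :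
    Δ.polyEval (MvPolynomial.monomial d (MonoidAlgebra.of ℕ ℤˣ s)) =
      signHom F (MonoidAlgebra.of ℕ ℤˣ s) * d.prod fun I k => Δ.toFun I ^ k := by
  rw [GPFun.polyEval, MvPolynomial.coe_eval₂Hom, MvPolynomial.eval₂_monomial]

theorem GPFun.polyEval_eps : Δ.polyEval (polyEps r E) = F.eps := by
  rw [GPFun.polyEval, polyEps, MvPolynomial.coe_eval₂Hom, MvPolynomial.eval₂_C, signHom_neg_one]

theorem GPFun.polyEval_X (I : RSubset r E) : Δ.polyEval (MvPolynomial.X I) = Δ.toFun I := by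
  rw [GPFun.polyEval, MvPolynomial.coe_eval₂Hom, MvPolynomial.eval₂_X]

/-- The evaluation `x_I ↦ Δ(I)` on the homogeneous coordinate blueprint of the matroid space. -/
def GPFun.ev : Hom (matAlg r E).toOBlpr F.toOBlpr :=
  pres.lift (A := polyMon r E) (h0 := ⟨0, Or.inl rfl⟩) (hA := polyMon_generates r E) Δ.polyEval (by
    rintro _ y ⟨rfl, rfl | ⟨I, J, hI, hJ, rfl⟩⟩
    · rw [map_zero, map_add, map_one, Δ.polyEval_eps]
      exact F.isPasture.pasteurized.eps_spec.2
    · rw [map_zero, map_pluckerSum, Δ.polyEval_eps]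
      simp only [Δ.polyEval_X]
      exact Δ.plucker I J hI hJ) (by
    rintro _ ⟨i, rfl | ⟨d, s, rfl, rfl⟩⟩
    · rw [map_zero]; exact F.zero_mem
    · rw [Δ.polyEval_monomial]
      exact F.mon.mul_mem (signHom_mem F s)
        (F.mon.prod_mem fun I _ => F.mon.pow_mem (Δ.mem I) _))

theorem GPFun.ev_mk (p : PolyRing r E) :
    Δ.ev.toRingHom (matMk r E p) = Δ.polyEval p := rfl

/-- The point of the matroid space given by a Grassmann-Plücker function: the prime `m`-ideal of
all `a` that vanish at `Δ`. -/
def GPFun.point : ProjPt (matAlg r E) where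
  carrier := {a | a ∈ (matAlg r E).mon ∧ Δ.ev.toRingHom a = 0}
  subset _ h := h.1
  zero_mem := ⟨(matAlg r E).zero_mem, map_zero _⟩
  mul_mem h hb := ⟨(matAlg r E).mon.mul_mem h.1 hb, by rw [map_mul, h.2, zero_mul]⟩
  one_notMem h := F.isPasture.zero_ne_one (by rw [← h.2, map_one])
  mul_notMem ha hb h h' hab := by
    refine F.isPasture.unit_ne_zero (F.unitGroup.mul_mem
      (F.isPasture.isUnitElt (Δ.ev.map_mon ha) fun k => h ⟨ha, k⟩)
      (F.isPasture.isUnitElt (Δ.ev.map_mon hb) fun k => h' ⟨hb, k⟩)) ?_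
    rw [← map_mul]
    exact hab.2
  relevant := by
    obtain ⟨I, hI⟩ := Δ.exists_unit
    refine ⟨1, one_pos, _, ⟨_, X_mem_polyPart I, rfl⟩, fun h => F.isPasture.unit_ne_zero hI ?_⟩
    exact (Δ.polyEval_X I).symm.trans ((Δ.ev_mk _).symm.trans h.2)

theorem GPFun.isUnitElt_ev {h : (matAlg r E).plus} (hm : h ∈ (matAlg r E).mon)
    (hh : h ∉ Δ.point.carrier) : F.IsUnitElt (Δ.ev.toRingHom h) :=
  F.isPasture.isUnitElt (Δ.ev.map_mon hm) fun k => hh ⟨hm, k⟩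

/-- The morphism `C_(x) → F`, `a / h ↦ a(Δ) / h(Δ)`, where `x` is the point given by `Δ`. -/
def GPFun.evLoc : Hom Δ.point.loc F.toOBlpr :=
  Δ.point.incl.comp (OBlpr.locLift Δ.ev fun _ hs => Δ.isUnitElt_ev hs.1 hs.2)

theorem GPFun.evLoc_frac {i : ℕ} (a h : (matAlg r E).part i)
    (hh : (h : (matAlg r E).plus) ∉ Δ.point.carrier) :
    Δ.ev.toRingHom h * Δ.evLoc.toRingHom (Δ.point.frac a h hh) = Δ.ev.toRingHom a :=
  locLift_frac (S := Δ.point.toMPrime.compl) Δ.ev (fun _ hs => Δ.isUnitElt_ev hs.1 hs.2)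
    (a : (matAlg r E).plus)
    ⟨h, (matAlg r E).part_subset _ h.2, hh⟩

theorem GPFun.evLoc_nonunit (z : Δ.point.loc.plus) (hz : z ∈ Δ.point.loc.mon)
    (hu : ¬ Δ.point.loc.IsUnitElt z) : Δ.evLoc.toRingHom z = 0 := by
  obtain ⟨i, a, h, hh, rfl⟩ := Δ.point.exists_frac hz
  have ha : (a : (matAlg r E).plus) ∈ Δ.point.carrier := by
    by_contra ha
    exact hu ⟨hz, _, Δ.point.frac_mem h a ha, Δ.point.frac_swap a h ha hh⟩
  have h1 := Δ.evLoc_frac a h hh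
  obtain ⟨_, c, _, hc⟩ := Δ.isUnitElt_ev ((matAlg r E).part_subset _ h.2) hh
  rw [ha.2] at h1
  have h2 := congrArg (fun z => c * z) h1
  beta_reduce at h2
  rwa [mul_zero, ← mul_assoc, mul_comm c, hc, one_mul] at h2

/-- The morphism `Spec F → Mat(r, E)` with homogeneous coordinates `Δ(I)`. -/
def GPFun.charMor : (Spec F.toOBlpr).Hom (Mat r E) :=
  pointMor Δ.point Δ.evLoc Δ.evLoc_nonunit

theorem GPFun.ev_scale {Δ Δ' : GPFun F r E} {c : F.plus}
    (h : ∀ I, Δ.toFun I = c * Δ'.toFun I) {i : ℕ} {a : (matAlg r E).plus}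
    (ha : a ∈ (matAlg r E).part i) : Δ.ev.toRingHom a = c ^ i * Δ'.ev.toRingHom a := by
  obtain ⟨p, hp, rfl⟩ := mem_matAlg_part.1 ha
  rw [Δ.ev_mk, Δ'.ev_mk]
  obtain rfl | ⟨d, s, rfl, rfl⟩ := hp
  · rw [map_zero, map_zero, mul_zero]
  · rw [Δ.polyEval_monomial, Δ'.polyEval_monomial, mul_left_comm]
    congr 1
    simp only [h, mul_pow, Finsupp.prod, Finset.prod_mul_distrib, Finset.prod_pow_eq_pow_sum]
    rfl

theorem pointMor_congr {C : GrOBlpr.{u}} {R : OBlpr.{v}} {x x' : ProjPt C} (h : x = x')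
    {φ : Hom x.loc R} {φ' : Hom x'.loc R}
    (hφ : ∀ z ∈ x.loc.mon, ¬ x.loc.IsUnitElt z → φ.toRingHom z = 0)
    (hφ' : ∀ z ∈ x'.loc.mon, ¬ x'.loc.IsUnitElt z → φ'.toRingHom z = 0)
    (hz : ∀ (i : ℕ) (a k : C.part i) (hk : (k : C.plus) ∉ x.carrier)
      (hk' : (k : C.plus) ∉ x'.carrier),
      φ.toRingHom (x.frac a k hk) = φ'.toRingHom (x'.frac a k hk')) :
    pointMor x φ hφ = pointMor x' φ' hφ' := by
  subst h
  obtain rfl : φ = φ' := hom_ext_mon fun z hzm => by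
    obtain ⟨i, a, k, hk, rfl⟩ := x.exists_frac hzm
    exact hz i a k hk hk
  rfl

theorem GPFun.charMor_congr {Δ Δ' : GPFun F r E} (h : Δ ≈ Δ') : Δ.charMor = Δ'.charMor := by
  obtain ⟨c, hc, h⟩ := h
  have hci : ∀ i : ℕ, F.IsUnitElt (c ^ i) := fun i => F.unitGroup.pow_mem hc i
  have hpt : Δ.point = Δ'.point := by
    ext a
    refine and_congr_right fun ha => ?_
    obtain ⟨i, hi⟩ := (matAlg r E).cover a ha
    rw [GPFun.ev_scale h hi]
    refine ⟨fun h0 => ?_, fun h0 => by rw [h0, mul_zero]⟩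
    obtain ⟨_, d, _, hd⟩ := hci i
    have h2 := congrArg (fun z => d * z) h0
    beta_reduce at h2
    rwa [mul_zero, ← mul_assoc, mul_comm d, hd, one_mul] at h2
  refine pointMor_congr hpt _ _ fun i a k hk hk' => ?_
  have h1 := Δ.evLoc_frac a k hk
  have h2 := Δ'.evLoc_frac a k hk'
  rw [GPFun.ev_scale h a.2, GPFun.ev_scale h k.2, ← h2, mul_assoc] at h1
  obtain ⟨_, d, _, hd⟩ :=
    F.unitGroup.mul_mem (hci i) (Δ'.isUnitElt_ev ((matAlg r E).part_subset _ k.2) hk')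
  have h3 := congrArg (fun z => d * z) h1
  beta_reduce at h3
  rwa [← mul_assoc, ← mul_assoc, mul_assoc d, mul_comm d, hd, one_mul, ← mul_assoc, ← mul_assoc,
    mul_assoc d, mul_comm d, hd, one_mul] at h3

/-- The characteristic morphism `χ_N : Spec F → Mat(r, E)` of an `F`-matroid `N`. -/
def FMatroid.charMor (N : FMatroid F r E) : (Spec F.toOBlpr).Hom (Mat r E) :=
  Quotient.lift GPFun.charMor (fun _ _ h => GPFun.charMor_congr h) N

end CharMor

/-! ### Universal pastures and realization spaces -/

/-- The prime `m`-ideal `{0}` of a pasture, which is the unique point of its spectrum. -/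
def Pasture.zeroPt (F : Pasture.{w}) : MPrime F.toOBlpr where
  carrier := {0}
  subset := by rintro _ rfl; exact F.zero_mem
  zero_mem := rfl
  mul_mem := by rintro _ b rfl _; exact zero_mul b
  one_notMem h := F.isPasture.zero_ne_one h.symm
  mul_notMem ha hb h h' := F.isPasture.unit_ne_zero (F.unitGroup.mul_mem
    (F.isPasture.isUnitElt ha h) (F.isPasture.isUnitElt hb h'))

/-- The residue field `k(x) = C_(x) // ⟨a = 0 | a not a unit⟩` of a point `x` of `Proj C`. -/
def ProjPt.residueField {C : GrOBlpr.{u}} (x : ProjPt C) : OBlpr.{u} :=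
  x.loc.quot fun y z => ∃ a ∈ x.loc.mon, ¬ x.loc.IsUnitElt a ∧ (y = a ∧ z = 0 ∨ y = 0 ∧ z = a)

/-- The canonical morphism `C_(x) → k(x)`. -/
def ProjPt.toResidueField {C : GrOBlpr.{u}} (x : ProjPt C) : Hom x.loc x.residueField :=
  OBlpr.toQuot _ _

theorem ProjPt.toResidueField_nonunit {C : GrOBlpr.{u}} (x : ProjPt C) (z : x.loc.plus)
    (hz : z ∈ x.loc.mon) (hu : ¬ x.loc.IsUnitElt z) : x.toResidueField.toRingHom z = 0 := by
  refine Eq.trans ((genCon_mk_eq _).2 ⟨?_, ?_⟩) (map_zero x.toResidueField.toRingHom)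
  · exact GenLE.of (Or.inr ⟨z, hz, hu, Or.inl ⟨rfl, rfl⟩⟩)
  · exact GenLE.of (Or.inr ⟨z, hz, hu, Or.inr ⟨rfl, rfl⟩⟩)

section Universal

variable {r : ℕ} {E : Type u} [LinearOrder E] (M : FMatroid Krasner r E)

/-- The support `x_M` of a matroid `M`: the image point of `χ_M : Spec 𝕂 → Mat(r, E)`. -/
def FMatroid.support : ProjPt (matAlg r E) := M.charMor.base Krasner.zeroPt

/-- The universal pasture `k_M = k(x_M)^±` of a matroid `M`. -/
def FMatroid.universalPasture : OBlpr.{u} := M.support.residueField.pasteurization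

/-- The inclusion `ι_M : Spec k_M → Spec k(x_M) → Mat(r, E)`. -/
def FMatroid.inclusion : (Spec M.universalPasture).Hom (Mat r E) :=
  (Spec.map M.support.residueField.toPasteurization).comp
    (pointMor M.support M.support.toResidueField M.support.toResidueField_nonunit)

/-- The realization space `𝒳_M(F)` of `M` over `F`. -/
def FMatroid.realizationSpace (F : Pasture.{w}) : Set ((Spec F.toOBlpr).Hom (Mat r E)) :=
  {χ | (Spec.map (terminalMap F)).comp χ = M.charMor}

end Universal

end OB

end

noncomputable section

namespace OB

open TopologicalSpace

/-! ### Morphisms from spectra of pastures that are given by a point -/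

/-! The spectrum of a pasture `F` is a single point, the ideal `{0}`, and its stalk is `F` itself. A
morphism `χ : Spec F → X` is therefore the same as an image point together with the values in `F` of
the sections near that point (`OBSpace.Hom.ext_value`). By locality, a section with nonzero value is
a unit near the image point (`OBSpace.Hom.isUnitAt_of_value_ne_zero`).

On the projective spectrum this becomes a statement about homogeneous coordinates. The image of `χ :
Spec F → Mat(r, E)` lies in some chart `x_K ≠ 0`, and the values of `x_I / x_K` form a
Grassmann–Plücker function whose characteristic morphism is `χ` (`gpOfMorphism_charMor`).
Conversely, the ratios `Δ(I) / Δ(K)` can be read off the characteristic morphism, so it determines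
`Δ` up to a unit (`GPFun.equiv_of_charMor_eq`). Hence `N ↦ χ_N` is a bijection from all `F`-matroids
to all morphisms `Spec F → Mat(r, E)`. It is compatible with push-forward (`FMatroid.charMor_push`).
Applied to `t_F`, and combined with injectivity over `𝕂`, this says that `χ_N` realizes `M` exactly
when `N` has underlying matroid `M`.

For the universal pasture, write `C` for the coordinate blueprint. A morphism out of `k(x_M)` is a
morphism out of `C_(x_M)` that kills the non-units, and pasteurization changes nothing for targets
in pastures. So `Hom(k_M, F)` is the set of morphisms `φ : C_(x_M) → F` killing non-units, and `f ↦
ι_M ∘ f^*` sends `φ` to the morphism `pointMor` that it defines. Every such morphism realizes `M`,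
because only one map `C_(x_M) → 𝕂` kills all non-units (`FMatroid.charMor_eq_pointMor`). Every
realization arises in this way, because composing with `t_F^*` does not move the image point
(`FMatroid.exists_eq_pointMor`). Only the universal property of `k_M` is used, not that it is itself
a pasture. -/

theorem IsUnitElt.mul_left_cancel {B : OBlpr.{u}} {a x y : B.plus} (ha : B.IsUnitElt a)
    (h : a * x = a * y) : x = y := by
  obtain ⟨_, b, _, hb⟩ := ha
  have h1 := congrArg (fun z => b * z) h
  beta_reduce at h1
  rwa [← mul_assoc, ← mul_assoc, mul_comm b, hb, one_mul, one_mul] at h1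

/-- A morphism of pastures is injective at `0` on the elements of the monoid. -/
theorem Hom.map_eq_zero_iff {F : Pasture.{v}} {F' : Pasture.{w}} (g : Hom F.toOBlpr F'.toOBlpr)
    {a : F.plus} (ha : a ∈ F.mon) : g.toRingHom a = 0 ↔ a = 0 := by
  refine ⟨fun h => ?_, fun h => by rw [h, map_zero]⟩
  by_contra h0
  exact F'.isPasture.unit_ne_zero (IsUnitElt.map g (F.isPasture.isUnitElt ha h0)) h

/-- A nonzero element of the ideal would be a unit and would force `1` into it. -/
theorem Pasture.eq_zeroPt (F : Pasture.{w}) (q : MPrime F.toOBlpr) : q = F.zeroPt := by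
  refine MPrime.ext (Set.Subset.antisymm (fun a ha => ?_) ?_)
  · by_contra h0
    obtain ⟨_, b, hb, hab⟩ := F.isPasture.isUnitElt (q.subset ha) h0
    exact q.one_notMem (hab ▸ q.mul_mem ha hb)
  · rintro _ rfl
    exact q.zero_mem

/-- Denominators lie outside `q`, so they are nonzero and already units of `F`. Equations in `F` can
thus be tested in the stalk. -/
theorem Pasture.toLoc_injective (F : Pasture.{w}) (q : MPrime F.toOBlpr) :
    Function.Injective (F.toLoc q.compl).toRingHom := by
  intro a b h
  rw [toLoc_apply, toLoc_apply, frac_eq_frac] at h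
  obtain ⟨u, hu⟩ := h
  rw [OneMemClass.coe_one, one_mul, one_mul] at hu
  refine IsUnitElt.mul_left_cancel (F.isPasture.isUnitElt u.2.1 fun h0 => u.2.2 ?_) hu
  rw [h0]
  exact q.zero_mem

theorem hom_ext_pointMor {C : GrOBlpr.{u}} {x : ProjPt C} {R : OBlpr.{v}} {φ φ' : Hom x.loc R}
    (hφ : ∀ z ∈ x.loc.mon, ¬ x.loc.IsUnitElt z → φ.toRingHom z = 0)
    (hφ' : ∀ z ∈ x.loc.mon, ¬ x.loc.IsUnitElt z → φ'.toRingHom z = 0) (h : φ = φ') :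
    pointMor x φ hφ = pointMor x φ' hφ' := by
  subst h
  rfl

/-- Both base maps are constant with value `x`, and the stalk map of `f` sends `z / 1` to `f(z) /
1`. This turns every composition of morphisms of spaces below into a composition of maps out of
`C_(x)`. -/
theorem specMap_comp_pointMor {C : GrOBlpr.{u}} (x : ProjPt C) {R : OBlpr.{v}} {R' : OBlpr.{w}}
    (φ : Hom x.loc R) (hφ : ∀ z ∈ x.loc.mon, ¬ x.loc.IsUnitElt z → φ.toRingHom z = 0)
    (f : Hom R R') (hφ' : ∀ z ∈ x.loc.mon, ¬ x.loc.IsUnitElt z →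
      (φ.comp f).toRingHom z = 0) :
    (Spec.map f).comp (pointMor x φ hφ) = pointMor x (φ.comp f) hφ' := by
  refine OBSpace.Hom.ext' (fun _ => rfl) fun V U hU hU' s hs => ?_
  refine (specData R').sections_ext fun q hq => ?_
  let z := φ.toRingHom (((projData C).eval x (hU q hq)).toRingHom s)
  change (stalkMap f q).toRingHom ((R.toLoc _).toRingHom z) =
    (R'.toLoc q.compl).toRingHom (f.toRingHom z)
  rw [toLoc_apply, toLoc_apply, stalkMap_frac]
  rw [frac_eq_frac]
  refine ⟨1, ?_⟩
  simp

theorem Hom.comp_nonunit {C : GrOBlpr.{u}} {x : ProjPt C} {R : OBlpr.{v}} {R' : OBlpr.{w}}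
    {φ : Hom x.loc R} (hφ : ∀ z ∈ x.loc.mon, ¬ x.loc.IsUnitElt z → φ.toRingHom z = 0)
    (f : Hom R R') (z : x.loc.plus) (hz : z ∈ x.loc.mon) (hu : ¬ x.loc.IsUnitElt z) :
    (φ.comp f).toRingHom z = 0 :=
  (congrArg f.toRingHom (hφ z hz hu)).trans (map_zero _)

/-- The section `a / h` over an open set on which `h` does not vanish. -/
def projSection {C : GrOBlpr.{u}} {V : Opens (ProjPt C)} {i : ℕ} (a h : C.part i)
    (hV : ∀ p ∈ V, (h : C.plus) ∉ p.carrier) : ((projData C).sections V).plus :=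
  (projData C).mkSection (fun p => p.1.frac a h (hV p.1 p.2))
    fun p => ⟨V, p.2, ⟨i, a, h⟩, fun y _ => ⟨hV y.1 y.2, rfl⟩⟩

theorem projSection_mem {C : GrOBlpr.{u}} {V : Opens (ProjPt C)} {i : ℕ} (a h : C.part i)
    (hV : ∀ p ∈ V, (h : C.plus) ∉ p.carrier) :
    projSection a h hV ∈ ((projData C).sections V).mon :=
  (projData C).mkSection_mem _ _

/-- Evaluation of the section `a / k` over the principal open of `k` recovers `φ` on fractions. The
points are kept as separate variables so that no map has to be transported along an equality `x =
x'`. -/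
theorem pointMor_frac {C : GrOBlpr.{u}} {F : Pasture.{v}} {x x' : ProjPt C}
    {φ : Hom x.loc F.toOBlpr} {φ' : Hom x'.loc F.toOBlpr}
    {hφ : ∀ z ∈ x.loc.mon, ¬ x.loc.IsUnitElt z → φ.toRingHom z = 0}
    {hφ' : ∀ z ∈ x'.loc.mon, ¬ x'.loc.IsUnitElt z → φ'.toRingHom z = 0}
    (h : pointMor x φ hφ = pointMor x' φ' hφ') {i : ℕ} (a k : C.part i)
    (hk : (k : C.plus) ∉ x.carrier) (hk' : (k : C.plus) ∉ x'.carrier) :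
    φ.toRingHom (x.frac a k hk) = φ'.toRingHom (x'.frac a k hk') := by
  let V := projOpen C k (C.part_subset _ k.2)
  let s : ((projData C).sections V).plus := projSection a k fun p hp => hp
  -- The component `app V ⊤` depends on a proof about the base map, so the equality is substituted
  -- for arbitrary morphisms and arbitrary such proofs.
  have key : ∀ (χ χ' : (Spec F.toOBlpr).Hom (Proj C)) (hχ : ∀ q ∈ (⊤ : Opens _), χ.base q ∈ V)
      (hχ' : ∀ q ∈ (⊤ : Opens _), χ'.base q ∈ V), χ = χ' →
      (χ.app V ⊤ hχ).toRingHom s = (χ'.app V ⊤ hχ').toRingHom s := by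
    rintro χ _ hχ hχ' rfl
    rfl
  have h1 := congrArg ((specData F.toOBlpr).eval F.zeroPt (U := ⊤) trivial).toRingHom
    (key (pointMor x φ hφ) (pointMor x' φ' hφ') (fun _ _ => hk) (fun _ _ => hk') h)
  exact F.toLoc_injective _ h1

theorem pointMor_injective {C : GrOBlpr.{u}} {F : Pasture.{v}} {x : ProjPt C}
    {φ φ' : Hom x.loc F.toOBlpr}
    {hφ : ∀ z ∈ x.loc.mon, ¬ x.loc.IsUnitElt z → φ.toRingHom z = 0}
    {hφ' : ∀ z ∈ x.loc.mon, ¬ x.loc.IsUnitElt z → φ'.toRingHom z = 0}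
    (h : pointMor x φ hφ = pointMor x φ' hφ') : φ = φ' :=
  hom_ext_mon fun z hz => by
    obtain ⟨i, a, k, hk, rfl⟩ := x.exists_frac hz
    exact pointMor_frac h a k hk hk

/-- A morphism from `C_(x)` to the Krasner hyperfield that kills all non-units is unique. -/
theorem hom_krasner_unique {C : GrOBlpr.{u}} {x : ProjPt C} {φ φ' : Hom x.loc krasner}
    (hφ : ∀ z ∈ x.loc.mon, ¬ x.loc.IsUnitElt z → φ.toRingHom z = 0)
    (hφ' : ∀ z ∈ x.loc.mon, ¬ x.loc.IsUnitElt z → φ'.toRingHom z = 0) : φ = φ' := by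
  refine hom_ext_mon fun z hz => ?_
  by_cases hu : x.loc.IsUnitElt z
  -- The only unit of `𝕂` is `1`, so there is no choice on units either.
  · have key : ∀ ψ : Hom x.loc krasner, ψ.toRingHom z = 1 := by
      intro ψ
      have h := IsUnitElt.map ψ hu
      obtain ⟨n, hn⟩ := ofNatK_surjective (ψ.toRingHom z)
      rw [← hn] at h ⊢
      rw [krasner_isUnitElt.1 h, map_one]
    rw [key, key]
  · rw [hφ z hz hu, hφ' z hz hu]

/-! ### Universal properties of residue fields and pasteurizations -/

theorem OBlpr.toQuot_surjective (B : OBlpr.{u}) (S : B.plus → B.plus → Prop) :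
    Function.Surjective (B.toQuot S).toRingHom := RingCon.mk'_surjective _

/-- The universal property of a quotient. -/
def OBlpr.quotLift {B : OBlpr.{u}} {S : B.plus → B.plus → Prop} {D : OBlpr.{v}} (f : Hom B D)
    (hf : ∀ x y, S x y → f.toRingHom x ≤ f.toRingHom y) : Hom (B.quot S) D :=
  pres.lift f.toRingHom (by
    rintro x y (h | h)
    · exact f.mono h
    · exact hf x y h) fun _ ha => f.map_mon ha

theorem OBlpr.toQuot_comp_quotLift {B : OBlpr.{u}} {S : B.plus → B.plus → Prop} {D : OBlpr.{v}}
    (f : Hom B D) (hf : ∀ x y, S x y → f.toRingHom x ≤ f.toRingHom y) :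
    (B.toQuot S).comp (OBlpr.quotLift f hf) = f := rfl

/-- Both elements are weak inverses of `b`. So the relations imposed by pasteurization hold
automatically in a pasteurized target. -/
theorem OBlpr.IsPasteurized.eq_of_common {D : OBlpr.{v}} (hD : D.IsPasteurized) {a a' b : D.plus}
    (ha : a ∈ D.mon) (ha' : a' ∈ D.mon) (hb : b ∈ D.mon) (h : 0 ≤ a + b) (h' : 0 ≤ a' + b) :
    a = a' :=
  (hD b hb).unique ⟨ha, by rwa [add_comm]⟩ ⟨ha', by rwa [add_comm]⟩

/-- The morphism `F₁^± → F` to a pasture. -/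
def F1pm.lift (F : Pasture.{w}) : Hom F1pm F.toOBlpr :=
  pres.lift (signHom F) (by
    rintro _ _ ⟨rfl, rfl⟩
    rw [map_zero, map_add, map_one, signHom_neg_one]
    exact F.isPasture.pasteurized.eps_spec.2) (by
    rintro _ (rfl | ⟨s, rfl⟩)
    · rw [map_zero]
      exact F.zero_mem
    · exact signHom_mem F s)

/-- The universal property of the tensor product over `F₁`. -/
def tensor.lift {B : OBlpr.{u}} {C : OBlpr.{v}} {D : OBlpr.{w}} (f : Hom B D) (g : Hom C D) :
    Hom (tensor B C) D :=
  pres.lift (Algebra.TensorProduct.productMap f.toRingHom.toNatAlgHom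
      g.toRingHom.toNatAlgHom).toRingHom (by
    rintro _ _ (⟨a, a', h, rfl, rfl⟩ | ⟨b, b', h, rfl, rfl⟩)
    · simpa using f.mono h
    · simpa using g.mono h) (by
    rintro _ ⟨a, ha, b, hb, rfl⟩
    simpa using D.mon.mul_mem (f.map_mon ha) (g.map_mon hb))

theorem tensor.inl_comp_lift {B : OBlpr.{u}} {C : OBlpr.{v}} {D : OBlpr.{w}} (f : Hom B D)
    (g : Hom C D) : (tensor.inl B C).comp (tensor.lift f g) = f := by
  refine hom_ext_mon fun a _ => ?_
  change (Algebra.TensorProduct.productMap f.toRingHom.toNatAlgHom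
    g.toRingHom.toNatAlgHom) (a ⊗ₜ[ℕ] 1) = _
  simp

/-- The inclusion of the second factor. -/
def tensor.inr (B : OBlpr.{u}) (C : OBlpr.{v}) : Hom C (tensor B C) where
  toRingHom := (genCon _).mk'.comp (Algebra.TensorProduct.includeRight (R := ℕ)
    (A := B.plus) (B := C.plus)).toRingHom
  mono h := GenLE.of (Or.inr ⟨_, _, h, rfl, rfl⟩)
  map_mon h := ⟨_, ⟨1, B.mon.one_mem, _, h, rfl⟩, rfl⟩

/-- Pure tensors generate, and `a ⊗ b = (a ⊗ 1)(1 ⊗ b)`. -/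
theorem tensor.hom_ext {B : OBlpr.{u}} {C : OBlpr.{v}} {D : OBlpr.{w}} {f g : Hom (tensor B C) D}
    (h : (tensor.inl B C).comp f = (tensor.inl B C).comp g)
    (h' : (tensor.inr B C).comp f = (tensor.inr B C).comp g) : f = g := by
  refine hom_ext_mon ?_
  rintro _ ⟨_, ⟨a, ha, b, hb, rfl⟩, rfl⟩
  let m : B.plus ⊗[ℕ] C.plus →+* (tensor B C).plus := (genCon _).mk'
  have h1 : m (a ⊗ₜ[ℕ] b) = (tensor.inl B C).toRingHom a * (tensor.inr B C).toRingHom b := by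
    change _ = m (a ⊗ₜ[ℕ] (1 : C.plus)) * m ((1 : B.plus) ⊗ₜ[ℕ] b)
    rw [← map_mul, Algebra.TensorProduct.tmul_mul_tmul, mul_one, one_mul]
  have h2 : f.toRingHom ((tensor.inl B C).toRingHom a) =
      g.toRingHom ((tensor.inl B C).toRingHom a) :=
    congrArg (fun k : Hom B D => k.toRingHom a) h
  have h3 : f.toRingHom ((tensor.inr B C).toRingHom b) =
      g.toRingHom ((tensor.inr B C).toRingHom b) :=
    congrArg (fun k : Hom C D => k.toRingHom b) h'
  refine (congrArg f.toRingHom h1).trans (Eq.trans ?_ (congrArg g.toRingHom h1).symm)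
  rw [map_mul, map_mul, h2, h3]

/-- The image of `ε` must be a weak inverse of `1`, and `D` has only one. -/
theorem F1pm.hom_unique {D : OBlpr.{w}} (hD : D.IsPasteurized) (f g : Hom F1pm D) : f = g := by
  refine hom_ext_mon ?_
  rintro _ ⟨_, rfl | ⟨s, rfl⟩, rfl⟩
  · exact (map_zero f.toRingHom).trans (map_zero g.toRingHom).symm
  rcases Int.units_eq_one_or s with rfl | rfl
  · exact (map_one f.toRingHom).trans (map_one g.toRingHom).symm
  · let e : F1pm.plus := (genCon signRel).mk' (MonoidAlgebra.of ℕ ℤˣ (-1))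
    have he : e ∈ F1pm.mon := ⟨_, Or.inr ⟨_, rfl⟩, rfl⟩
    have h0 : (0 : F1pm.plus) ≤ 1 + e := GenLE.of ⟨rfl, rfl⟩
    have key : ∀ k : Hom F1pm D, k.toRingHom e ∈ D.mon ∧ 0 ≤ 1 + k.toRingHom e := fun k =>
      ⟨k.map_mon he, by simpa using k.mono h0⟩
    exact (hD 1 D.mon.one_mem).unique (key f) (key g)

/-- Morphisms from a pasteurization to a pasteurized blueprint are determined by their restriction
along the canonical morphism. -/
theorem OBlpr.pasteurization_hom_ext {B : OBlpr.{u}} {D : OBlpr.{w}} (hD : D.IsPasteurized)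
    {f g : Hom B.pasteurization D}
    (h : B.toPasteurization.comp f = B.toPasteurization.comp g) : f = g := by
  -- The factor `F₁^±` admits at most one morphism to `D`, so agreement on the factor `B` suffices.
  have h1 : (OBlpr.toQuot (tensor B F1pm) _).comp f = (OBlpr.toQuot (tensor B F1pm) _).comp g :=
    tensor.hom_ext h (F1pm.hom_unique hD _ _)
  refine Hom.ext (RingHom.ext fun z => ?_)
  obtain ⟨y, rfl⟩ := OBlpr.toQuot_surjective _ _ z
  exact congrArg (fun k : Hom (tensor B F1pm) D => k.toRingHom y) h1

/-- Every morphism from a blueprint to a pasture extends to its pasteurization. -/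
theorem OBlpr.exists_pasteurization_lift {B : OBlpr.{u}} {F : Pasture.{w}}
    (f : Hom B F.toOBlpr) : ∃ g : Hom B.pasteurization F.toOBlpr, B.toPasteurization.comp g = f := by
  let k := tensor.lift f (F1pm.lift F)
  refine ⟨OBlpr.quotLift k ?_, tensor.inl_comp_lift f (F1pm.lift F)⟩
  rintro a a' ⟨ha, ha', b, hb, h, h'⟩
  -- Elements identified by the pasteurization have a common weak inverse `b`, hence so do their
  -- images, which then coincide in `F`.
  refine (F.isPasture.pasteurized.eq_of_common (k.map_mon ha) (k.map_mon ha') (k.map_mon hb)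
    ?_ ?_).le
  · simpa using k.mono h
  · simpa using k.mono h'

/-- A morphism that kills all non-units factors through the residue field. -/
theorem ProjPt.exists_residueField_lift {C : GrOBlpr.{u}} (x : ProjPt C) {D : OBlpr.{w}}
    (φ : Hom x.loc D) (hφ : ∀ z ∈ x.loc.mon, ¬ x.loc.IsUnitElt z → φ.toRingHom z = 0) :
    ∃ g : Hom x.residueField D, x.toResidueField.comp g = φ := by
  refine ⟨OBlpr.quotLift φ ?_, OBlpr.toQuot_comp_quotLift _ _⟩
  rintro y z ⟨a, ha, hu, ⟨rfl, rfl⟩ | ⟨rfl, rfl⟩⟩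
  · rw [hφ _ ha hu, map_zero]
  · rw [hφ _ ha hu, map_zero]

theorem ProjPt.residueField_hom_ext {C : GrOBlpr.{u}} (x : ProjPt C) {D : OBlpr.{w}}
    {f g : Hom x.residueField D} (h : x.toResidueField.comp f = x.toResidueField.comp g) :
    f = g := by
  refine Hom.ext (RingHom.ext fun z => ?_)
  obtain ⟨y, rfl⟩ := OBlpr.toQuot_surjective _ _ z
  exact congrArg (fun k : Hom x.loc D => k.toRingHom y) h

/-! ### Morphisms from the spectrum of a pasture -/

/-- The identity morphism. -/
def Hom.id (B : OBlpr.{u}) : Hom B B := ⟨RingHom.id B.plus, fun h => h, fun h => h⟩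

/-- A pasture is its own localization at the zero ideal. -/
def Pasture.unloc (F : Pasture.{w}) : Hom (F.loc F.zeroPt.compl) F.toOBlpr :=
  OBlpr.locLift (Hom.id F.toOBlpr) fun _ hs => F.isPasture.isUnitElt hs.1 hs.2

theorem Pasture.toLoc_unloc (F : Pasture.{w}) (z : (F.loc F.zeroPt.compl).plus) :
    (F.toLoc F.zeroPt.compl).toRingHom (F.unloc.toRingHom z) = z := by
  obtain ⟨a, s, rfl⟩ := frac_surjective z
  have h : (s : F.plus) * F.unloc.toRingHom (OBlpr.frac a s) = a :=
    locLift_frac (Hom.id F.toOBlpr) _ a s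
  rw [toLoc_apply, frac_eq_frac]
  exact ⟨1, by rw [h, OneMemClass.coe_one, one_mul, one_mul]⟩

theorem Pasture.unloc_toLoc (F : Pasture.{w}) (z : F.plus) :
    F.unloc.toRingHom ((F.toLoc F.zeroPt.compl).toRingHom z) = z :=
  F.toLoc_injective _ (F.toLoc_unloc _)

/-! ### Values of sections at an `F`-valued point -/

section Value

variable {F : Pasture.{w}} {X : OBSpace.{u}}

/-- The image of the unique point of the spectrum of a pasture. -/
def OBSpace.Hom.image (χ : (Spec F.toOBlpr).Hom X) : X.pt := χ.base F.zeroPt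

theorem OBSpace.Hom.base_eq_image (χ : (Spec F.toOBlpr).Hom X) (q : MPrime F.toOBlpr) :
    χ.base q = χ.image := by
  rw [F.eq_zeroPt q]
  rfl

theorem OBSpace.Hom.base_mem (χ : (Spec F.toOBlpr).Hom X) {V : Opens X.pt} (hV : χ.image ∈ V)
    (q : MPrime F.toOBlpr) : χ.base q ∈ V :=
  (χ.base_eq_image q).symm ▸ hV

/-- The value in `F` of sections at a morphism `Spec F → X`. -/
def OBSpace.Hom.value (χ : (Spec F.toOBlpr).Hom X) (V : Opens X.pt) (hV : χ.image ∈ V) :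
    OB.Hom (X.sec V) F.toOBlpr :=
  ((χ.app V ⊤ fun q _ => χ.base_mem hV q).comp
    ((specData F.toOBlpr).eval (U := ⊤) F.zeroPt trivial)).comp F.unloc

/-- The defining property of `value`: inside the stalk of `Spec F` it is the germ of the pulled-back
section. With `Pasture.toLoc_injective`, identities of values can be checked on germs. -/
theorem OBSpace.Hom.toLoc_value (χ : (Spec F.toOBlpr).Hom X) {V : Opens X.pt}
    (hV : χ.image ∈ V) (s : (X.sec V).plus) :
    (F.toLoc F.zeroPt.compl).toRingHom ((χ.value V hV).toRingHom s) =
      ((specData F.toOBlpr).eval (U := ⊤) F.zeroPt trivial).toRingHom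
        ((χ.app V ⊤ fun q _ => χ.base_mem hV q).toRingHom s) :=
  F.toLoc_unloc _

theorem OBSpace.Hom.value_res (χ : (Spec F.toOBlpr).Hom X) {V V' : Opens X.pt} (h : V' ≤ V)
    (hV : χ.image ∈ V) (hV' : χ.image ∈ V') (s : (X.sec V).plus) :
    (χ.value V' hV').toRingHom ((X.res h).toRingHom s) = (χ.value V hV).toRingHom s := by
  refine F.toLoc_injective F.zeroPt ?_
  rw [χ.toLoc_value, χ.toLoc_value]
  refine congrArg ((specData F.toOBlpr).eval (U := ⊤) F.zeroPt trivial).toRingHom ?_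
  exact (χ.natural h (le_refl ⊤) (fun q _ => χ.base_mem hV q)
    (fun q _ => χ.base_mem hV' q) s).symm

/-- A section over an open subset of a one-point spectrum is determined by its germ at that point,
if the subset contains it. -/
theorem OBSpace.Hom.ext_value {χ χ' : (Spec F.toOBlpr).Hom X} (h : χ.image = χ'.image)
    (h' : ∀ V (hV : χ.image ∈ V) (hV' : χ'.image ∈ V), ∀ s ∈ (X.sec V).mon,
      (χ.value V hV).toRingHom s = (χ'.value V hV').toRingHom s) : χ = χ' := by
  refine OBSpace.Hom.ext' (fun q => ?_) fun V U hU hU' s hs => ?_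
  · exact (χ.base_eq_image q).trans (h.trans (χ'.base_eq_image q).symm)
  refine (specData F.toOBlpr).sections_ext fun q hq => ?_
  obtain rfl := F.eq_zeroPt q
  have hV : χ.image ∈ V := hU _ hq
  have hV' : χ'.image ∈ V := hU' _ hq
  have h1 := congrArg (F.toLoc F.zeroPt.compl).toRingHom (h' V hV hV' s hs)
  rw [χ.toLoc_value, χ'.toLoc_value] at h1
  -- Values are defined over the whole spectrum; naturality for `U ≤ ⊤` carries them to `U`.
  have key : ∀ (ψ : (Spec F.toOBlpr).Hom X) (hψ : ∀ x ∈ U, ψ.base x ∈ V) (hψ' : ψ.image ∈ V),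
      ((specData F.toOBlpr).eval F.zeroPt hq).toRingHom ((ψ.app V U hψ).toRingHom s) =
      ((specData F.toOBlpr).eval (U := ⊤) F.zeroPt trivial).toRingHom
        ((ψ.app V ⊤ fun q _ => ψ.base_mem hψ' q).toRingHom s) := by
    intro ψ hψ hψ'
    have h2 := ψ.natural (le_refl V) (le_top : U ≤ ⊤) (fun q _ => ψ.base_mem hψ' q) hψ s
    rw [X.res_self] at h2
    exact (congrArg ((specData F.toOBlpr).eval F.zeroPt hq).toRingHom h2).symm
  exact (key χ hU hV).trans (h1.trans (key χ' hU' hV').symm)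

/-- This is where locality of `χ` enters: a nonzero value makes the pulled-back section a unit at
the point of `Spec F`, and local morphisms reflect units. -/
theorem OBSpace.Hom.isUnitAt_of_value_ne_zero (χ : (Spec F.toOBlpr).Hom X) {V : Opens X.pt}
    (hV : χ.image ∈ V) {s : (X.sec V).plus} (hs : s ∈ (X.sec V).mon)
    (h : (χ.value V hV).toRingHom s ≠ 0) : X.IsUnitAt s χ.image := by
  refine χ.isLocal V ⊤ (fun q _ => χ.base_mem hV q) s hs F.zeroPt trivial ?_
  refine spec_isUnitAt ((χ.app V ⊤ _).map_mon hs) trivial ?_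
  -- A germ that is not a unit has its numerator in the ideal `{0}`, so it vanishes.
  rintro _ rfl t ht
  refine h (F.toLoc_injective F.zeroPt ?_)
  rw [χ.toLoc_value, map_zero]
  exact ht.trans (frac_zero _)

end Value

theorem value_pointMor {C : GrOBlpr.{u}} {F : Pasture.{w}} (x : ProjPt C)
    (φ : Hom x.loc F.toOBlpr)
    (hφ : ∀ z ∈ x.loc.mon, ¬ x.loc.IsUnitElt z → φ.toRingHom z = 0) (V : Opens (ProjPt C))
    (hV : x ∈ V) (s : ((projData C).sections V).plus) :
    ((pointMor x φ hφ).value V hV).toRingHom s =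
      φ.toRingHom (((projData C).eval x hV).toRingHom s) :=
  F.unloc_toLoc _

/-! ### Morphisms from the spectrum of a pasture to a projective spectrum -/

section ProjValue

variable {C : GrOBlpr.{u}}

/-- The value of a section in the full localization at a point. -/
def evalFull {V : Opens (ProjPt C)} (p : ProjPt C) (hp : p ∈ V) :
    Hom ((projData C).sections V) p.fullLoc := ((projData C).eval p hp).comp p.incl

theorem proj_sections_le {V : Opens (ProjPt C)} {s t : ((projData C).sections V).plus} :
    s ≤ t ↔ ∀ p (hp : p ∈ V), (evalFull p hp).toRingHom s ≤ (evalFull p hp).toRingHom t :=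
  (projData C).sections_le

theorem proj_sections_ext {V : Opens (ProjPt C)} {s t : ((projData C).sections V).plus}
    (h : ∀ p (hp : p ∈ V), (evalFull p hp).toRingHom s = (evalFull p hp).toRingHom t) : s = t :=
  (projData C).sections_ext fun p hp => p.incl_injective (h p hp)

/-- The factors `a` and `1 / h` need not have degree zero, so this splitting lives only in the full
localization. That is why computations with sections are made there rather than in `C_(p)`. -/
theorem evalFull_projSection {V : Opens (ProjPt C)} {i : ℕ} (a h : C.part i)
    (hV : ∀ p ∈ V, (h : C.plus) ∉ p.carrier) (p : ProjPt C) (hp : p ∈ V) :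
    (evalFull p hp).toRingHom (projSection a h hV) =
      (C.toLoc p.toMPrime.compl).toRingHom a *
        OBlpr.frac (S := p.toMPrime.compl) 1 ⟨h, C.part_subset _ h.2, hV p hp⟩ := by
  rw [toLoc_apply, frac_mul_frac, mul_one, one_mul]
  rfl

theorem projSection_mul_projSection {V : Opens (ProjPt C)} {i : ℕ} (a h k : C.part i)
    (hh : ∀ p ∈ V, (h : C.plus) ∉ p.carrier) (hk : ∀ p ∈ V, (k : C.plus) ∉ p.carrier) :
    projSection a h hh * projSection h k hk = projSection a k hk := by
  refine proj_sections_ext fun p hp => ?_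
  rw [map_mul, evalFull_projSection, evalFull_projSection, evalFull_projSection, toLoc_apply,
    toLoc_apply, frac_mul_frac, frac_mul_frac, frac_mul_frac, frac_mul_frac, frac_eq_frac]
  exact ⟨1, by push_cast; ring⟩

variable {F : Pasture.{w}} (χ : (Spec F.toOBlpr).Hom (Proj C))

/-- The image point of a morphism to a projective spectrum. -/
def projImage : ProjPt C := χ.image

/-- The prime ideal of the image point can be read off from vanishing of values. If `a` is outside
the ideal, then `a / h` is invertible near the image and has invertible value. If `a` is inside,
then `a / h` is not a unit there, and locality forces the value to be `0`. -/
theorem value_projSection_eq_zero_iff {V : Opens (ProjPt C)} (hV : projImage χ ∈ V) {i : ℕ}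
    (a h : C.part i) (hh : ∀ p ∈ V, (h : C.plus) ∉ p.carrier) :
    (χ.value V hV).toRingHom (projSection a h hh) = 0 ↔ (a : C.plus) ∈ (projImage χ).carrier := by
  constructor
  · intro h0
    by_contra ha
    -- On this smaller neighbourhood of the image, `h / a` is an inverse of `a / h`.
    let V' := V ⊓ projOpen C a (C.part_subset _ a.2)
    have hV' : projImage χ ∈ V' := ⟨hV, ha⟩
    have h1 := χ.value_res (inf_le_left : V' ≤ V) hV hV' (projSection a h hh)
    have h2 : projSection (V := V') a h (fun p hp => hh p hp.1) *
        projSection (V := V') h a (fun p hp => hp.2) = 1 :=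
      (projData C).sections_ext fun p hp =>
        (map_mul _ _ _).trans ((p.frac_swap a h hp.2 (hh p hp.1)).trans (map_one _).symm)
    have h3 := congrArg (χ.value V' hV').toRingHom h2
    have h4 := (map_mul (χ.value V' hV').toRingHom _ _).symm.trans (h3.trans (map_one _))
    have h5 := h1.trans h0
    refine F.isPasture.zero_ne_one (Eq.trans ?_ h4)
    exact (zero_mul _).symm.trans (congrArg (· * _) h5.symm)
  · intro ha
    by_contra h0
    obtain ⟨z, hz, h1⟩ := (projData C).eval_of_isUnitAt
      (χ.isUnitAt_of_value_ne_zero hV (projSection_mem a h hh) h0) hV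
    exact (projImage χ).frac_not_isUnit a h ha (hh _ hV)
      ⟨(projImage χ).frac_mem _ _ _, z, hz, h1⟩

end ProjValue

/-! ### Homogeneity of powers and of Plücker sums -/

theorem GrOBlpr.pow_mem_part (C : GrOBlpr.{u}) {a : C.plus} (ha : a ∈ C.part 1) (i : ℕ) :
    a ^ i ∈ C.part i := by
  induction i with
  | zero => rw [pow_zero]; exact C.one_mem_part
  | succ i ih => rw [pow_succ]; exact C.mul_mem_part ih ha

theorem extendZero_mul {r : ℕ} {E : Type u} {R : Type v} [CommSemiring R] (Δ : RSubset r E → R)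
    (c : R) (I : Finset E) : extendZero (fun K => Δ K * c) I = extendZero Δ I * c := by
  unfold extendZero
  split_ifs
  · rfl
  · rw [zero_mul]

/-- Plücker sums are homogeneous of degree two, so they may be dehomogenized by a coordinate. -/
theorem pluckerSum_mul {r : ℕ} {E : Type u} [LinearOrder E] {R : Type v} [CommSemiring R] (ε : R)
    (Δ : RSubset r E → R) (c : R) (I J : Finset E) (hI : I.card = r + 1) :
    pluckerSum ε (fun K => Δ K * c) I J hI = pluckerSum ε Δ I J hI * (c * c) := by
  unfold pluckerSum
  rw [Finset.sum_mul]
  refine Finset.sum_congr rfl fun k _ => ?_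
  rw [extendZero_mul, extendZero_mul]
  ring

/-! ### Morphisms from the spectrum of a pasture to the matroid space -/

section MatMorphism

variable {r : ℕ} {E : Type u} [LinearOrder E]

/-- The coordinate `x_I`. -/
def coord (I : RSubset r E) : (matAlg r E).part 1 :=
  ⟨matMk r E (MvPolynomial.X I), _, X_mem_polyPart I, rfl⟩

/-- The coefficients `1` and `ε`. -/
def coeffPart (r : ℕ) (E : Type u) [LinearOrder E] (s : ℤˣ) : (matAlg r E).part 0 :=
  ⟨matMk r E (MvPolynomial.C (MonoidAlgebra.of ℕ ℤˣ s)), _, Or.inr ⟨0, s, map_zero _, rfl⟩, rfl⟩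

/-- The power `x_I ^ i`. -/
def coordPow (I : RSubset r E) (i : ℕ) : (matAlg r E).part i :=
  ⟨(coord I : (matAlg r E).plus) ^ i, (matAlg r E).pow_mem_part (coord I).2 i⟩

/-- The principal open set where `x_I` does not vanish. -/
def chart (I : RSubset r E) : Opens (ProjPt (matAlg r E)) :=
  projOpen _ (coord I) ((matAlg r E).part_subset _ (coord I).2)

theorem coord_notMem {I : RSubset r E} (p : ProjPt (matAlg r E)) (hp : p ∈ chart I) :
    (coord I : (matAlg r E).plus) ∉ p.carrier := hp

theorem coordPow_notMem {I : RSubset r E} (i : ℕ) (p : ProjPt (matAlg r E)) (hp : p ∈ chart I) :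
    (coordPow I i : (matAlg r E).plus) ∉ p.carrier :=
  (p.toMPrime.compl.pow_mem ⟨(matAlg r E).part_subset _ (coord I).2, coord_notMem p hp⟩ i).2

/-- Relevance of `p` yields a monomial of positive degree outside `p`. No variable dividing it can
lie in `p`. -/
theorem exists_mem_chart (p : ProjPt (matAlg r E)) : ∃ I, p ∈ chart I := by
  obtain ⟨i, hi, _, ⟨m, hm, rfl⟩, hp⟩ := p.relevant
  obtain rfl | ⟨d, s, rfl, rfl⟩ := hm
  · exact absurd p.zero_mem (by rwa [map_zero] at hp)
  have hd : d ≠ 0 := by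
    rintro rfl
    simp at hi
  obtain ⟨I, hI⟩ := Finsupp.support_nonempty_iff.2 hd
  refine ⟨I, fun h => hp ?_⟩
  have h1 : MvPolynomial.monomial d (MonoidAlgebra.of ℕ ℤˣ s) = MvPolynomial.X I *
      MvPolynomial.monomial (d - Finsupp.single I 1) (MonoidAlgebra.of ℕ ℤˣ s) := by
    rw [MvPolynomial.X, MvPolynomial.monomial_mul, one_mul, add_tsub_cancel_of_le]
    rw [Finsupp.single_le_iff]
    exact Nat.one_le_iff_ne_zero.2 (Finsupp.mem_support_iff.1 hI)
  rw [h1]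
  have h2 := p.mul_mem h (b := matMk r E (MvPolynomial.monomial (d - Finsupp.single I 1)
    (MonoidAlgebra.of ℕ ℤˣ s))) ⟨_, ⟨_, Or.inr ⟨_, _, rfl, rfl⟩⟩, rfl⟩
  exact (map_mul (matMk r E) _ _).symm ▸ h2

/-- The section `x_I / x_K` over the chart of `x_K`. -/
def coordSection (K I : RSubset r E) : ((projData (matAlg r E)).sections (chart K)).plus :=
  projSection (coord I) (coord K) coord_notMem

/-- The constant sections `1` and `ε`. -/
def coeffSection (V : Opens (ProjPt (matAlg r E))) (s : ℤˣ) :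
    ((projData (matAlg r E)).sections V).plus :=
  projSection (coeffPart r E s) ⟨1, (matAlg r E).one_mem_part⟩ fun p _ => p.one_notMem

theorem evalFull_coeffSection {V : Opens (ProjPt (matAlg r E))} (s : ℤˣ)
    (p : ProjPt (matAlg r E)) (hp : p ∈ V) :
    (evalFull p hp).toRingHom (coeffSection V s) =
      ((matAlg r E).toLoc p.toMPrime.compl).toRingHom (coeffPart r E s) := by
  rw [coeffSection, evalFull_projSection]
  exact (congrArg (_ * ·) frac_one).trans (mul_one _)

theorem coeffSection_one (V : Opens (ProjPt (matAlg r E))) : coeffSection V 1 = 1 := by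
  refine proj_sections_ext fun p hp => ?_
  rw [evalFull_coeffSection, map_one]
  have h : ((coeffPart r E 1 : (matAlg r E).part 0) : (matAlg r E).plus) = 1 := by
    refine Eq.trans (congrArg (matMk r E) ?_) (map_one (matMk r E))
    rw [map_one, map_one]
  rw [h, map_one]

theorem zero_le_one_add_coeffSection (V : Opens (ProjPt (matAlg r E))) :
    0 ≤ 1 + coeffSection V (-1) := by
  refine proj_sections_le.2 fun p hp => ?_
  rw [map_add, map_one, map_zero, evalFull_coeffSection,
    ← map_one ((matAlg r E).toLoc p.toMPrime.compl).toRingHom, ← map_add,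
    ← map_zero ((matAlg r E).toLoc p.toMPrime.compl).toRingHom]
  exact Hom.mono _ (GenLE.of ⟨rfl, Or.inl rfl⟩)

/-- In each full localization, this is the defining Plücker relation of `matAlg` multiplied by `(1 /
x_K)²`. -/
theorem coordSection_plucker (K : RSubset r E) (I J : Finset E) (hI : I.card = r + 1)
    (hJ : J.card + 1 = r) :
    0 ≤ pluckerSum (coeffSection (chart K) (-1)) (coordSection K) I J hI := by
  refine proj_sections_le.2 fun p hp => ?_
  let τ := ((matAlg r E).toLoc p.toMPrime.compl).toRingHom.comp (matMk r E)
  have h1 : (0 : p.fullLoc.plus) ≤ τ (pluckerSum (polyEps r E) MvPolynomial.X I J hI) := by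
    rw [← map_zero ((matAlg r E).toLoc p.toMPrime.compl).toRingHom]
    exact Hom.mono _ (GenLE.of ⟨rfl, Or.inr ⟨I, J, hI, hJ, rfl⟩⟩)
  rw [map_pluckerSum] at h1
  rw [map_zero, map_pluckerSum, evalFull_coeffSection]
  simp only [coordSection, evalFull_projSection]
  rw [pluckerSum_mul]
  have h2 := p.fullLoc.mul_le h1 (le_refl
    (OBlpr.frac (S := p.toMPrime.compl) 1 ⟨coord K, (matAlg r E).part_subset _ (coord K).2,
        coord_notMem p hp⟩ *
      OBlpr.frac (S := p.toMPrime.compl) 1 ⟨coord K, (matAlg r E).part_subset _ (coord K).2,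
        coord_notMem p hp⟩))
  rw [zero_mul] at h2
  exact h2

/-- Dehomogenization: each of the `d.degree` variables of the monomial absorbs one factor `1 / x_K`.
-/
theorem projSection_monomial (K : RSubset r E) (d : RSubset r E →₀ ℕ) (s : ℤˣ)
    (h : matMk r E (MvPolynomial.monomial d (MonoidAlgebra.of ℕ ℤˣ s)) ∈
      (matAlg r E).part d.degree) :
    projSection ⟨_, h⟩ (coordPow K d.degree) (coordPow_notMem d.degree) =
      coeffSection (chart K) s * d.prod fun I k => coordSection K I ^ k := by
  refine proj_sections_ext fun p hp => ?_
  let τ := ((matAlg r E).toLoc p.toMPrime.compl).toRingHom.comp (matMk r E)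
  let k : p.toMPrime.compl := ⟨coord K, (matAlg r E).part_subset _ (coord K).2, coord_notMem p hp⟩
  let c : p.fullLoc.plus := OBlpr.frac 1 k
  have hc : ∀ i : ℕ, OBlpr.frac 1 (k ^ i) = c ^ i := by
    intro i
    induction i with
    | zero => rw [pow_zero, pow_zero]; exact frac_one
    | succ i ih => rw [pow_succ, pow_succ, ← ih, frac_mul_frac, one_mul]
  have h1 : ∀ I, (evalFull p hp).toRingHom (coordSection K I) = τ (MvPolynomial.X I) * c :=
    fun I => evalFull_projSection _ _ _ p hp
  have h2 : (evalFull p hp).toRingHom (coeffSection (chart K) s) =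
      τ (MvPolynomial.C (MonoidAlgebra.of ℕ ℤˣ s)) := evalFull_coeffSection s p hp
  have h3 : (evalFull p hp).toRingHom
      (projSection ⟨_, h⟩ (coordPow K d.degree) (coordPow_notMem d.degree)) =
      τ (MvPolynomial.monomial d (MonoidAlgebra.of ℕ ℤˣ s)) * c ^ d.degree := by
    rw [← hc, evalFull_projSection]
    rfl
  rw [h3, map_mul, h2, MvPolynomial.monomial_eq, map_mul, mul_assoc]
  congr 1
  -- The powers of `c` contributed by the variables combine to the exponent `∑ d I`, which is the
  -- degree.
  simp only [Finsupp.prod, map_prod, map_pow, h1, mul_pow, Finset.prod_mul_distrib,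
    Finset.prod_pow_eq_pow_sum]
  rfl

/-! ### The Grassmann–Plücker function of a morphism -/

variable {F : Pasture.{w}} (χ : (Spec F.toOBlpr).Hom (Mat r E))

/-- Values preserve the order, so the section `ε` goes to a weak inverse of `1` in `F`, which is
unique. -/
theorem value_coeffSection {V : Opens (ProjPt (matAlg r E))} (hV : χ.image ∈ V) (s : ℤˣ) :
    (χ.value V hV).toRingHom (coeffSection V s) = signHom F (MonoidAlgebra.of ℕ ℤˣ s) := by
  rcases Int.units_eq_one_or s with rfl | rfl
  · rw [map_one, map_one, coeffSection_one]
    exact map_one _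
  · rw [signHom_neg_one]
    refine (F.isPasture.pasteurized 1 F.mon.one_mem).unique
      ⟨(χ.value V hV).map_mon (projSection_mem _ _ _), ?_⟩ F.isPasture.pasteurized.eps_spec
    have h := (χ.value V hV).mono (zero_le_one_add_coeffSection V)
    have h1 := (map_add (χ.value V hV).toRingHom 1 (coeffSection V (-1)))
    have h2 := map_one (χ.value V hV).toRingHom
    exact (map_zero (χ.value V hV).toRingHom).symm.le.trans
      ((h.trans h1.le).trans (congrArg (· + _) h2).le)

/-- The Grassmann-Plücker function of a morphism `Spec F → Mat(r, E)` whose image lies in the chart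
of `x_K`. -/
def gpOfMorphism (K : RSubset r E) (hK : χ.image ∈ chart K) : GPFun F r E where
  toFun I := (χ.value (chart K) hK).toRingHom (coordSection K I)
  mem I := (χ.value (chart K) hK).map_mon (projSection_mem _ _ _)
  -- The entry at `K` is the value of `x_K / x_K`, nonzero since `x_K` is outside the ideal of the
  -- image point.
  exists_unit := ⟨K, F.isPasture.isUnitElt ((χ.value (chart K) hK).map_mon (projSection_mem _ _ _))
    fun h => hK ((value_projSection_eq_zero_iff χ hK _ _ _).1 h)⟩
  plucker I J hI hJ := by
    have h := (χ.value (chart K) hK).mono (coordSection_plucker K I J hI hJ)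
    have h1 := map_pluckerSum (χ.value (chart K) hK).toRingHom (coeffSection (chart K) (-1))
      (coordSection K) I J hI
    rw [value_coeffSection, signHom_neg_one] at h1
    exact (map_zero (χ.value (chart K) hK).toRingHom).symm.le.trans (h.trans h1.le)

/-- Elements of degree `i` are `0` or monomials with a sign coefficient, and `projSection_monomial`
writes a monomial divided by `x_K ^ i` through the sections whose values define the function. -/
theorem gpOfMorphism_ev (K : RSubset r E) (hK : χ.image ∈ chart K) {i : ℕ}
    (a : (matAlg r E).part i) :
    (gpOfMorphism χ K hK).ev.toRingHom a = (χ.value (chart K) hK).toRingHom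
      (projSection a (coordPow K i) (coordPow_notMem i)) := by
  obtain ⟨_, m, hm, rfl⟩ := a
  obtain rfl | ⟨d, s, rfl, rfl⟩ := hm
  -- The fraction `0 / x_K ^ i` has value zero because `0` belongs to the ideal of the image point.
  · have h1 := (value_projSection_eq_zero_iff χ hK
      ⟨matMk r E 0, 0, Or.inl rfl, rfl⟩ (coordPow K i) (coordPow_notMem i)).2
      (by
        have := (projImage χ).zero_mem
        rw [← map_zero (matMk r E)] at this
        exact this)
    refine Eq.trans ?_ h1.symm
    exact ((gpOfMorphism χ K hK).ev_mk 0).trans (map_zero _)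
  · refine ((gpOfMorphism χ K hK).ev_mk _).trans ?_
    rw [GPFun.polyEval_monomial]
    have h1 := congrArg (χ.value (chart K) hK).toRingHom
      (projSection_monomial K d s ⟨_, Or.inr ⟨d, s, rfl, rfl⟩, rfl⟩)
    refine Eq.trans ?_ h1.symm
    refine Eq.trans ?_ (map_mul (χ.value (chart K) hK).toRingHom _ _).symm
    rw [value_coeffSection]
    congr 1
    simp only [Finsupp.prod]
    refine Eq.trans ?_ (map_prod (χ.value (chart K) hK).toRingHom _ _).symm
    refine Finset.prod_congr rfl fun I _ => ?_
    exact (map_pow (χ.value (chart K) hK).toRingHom _ _).symm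

/-- A homogeneous `a` of degree `i` vanishes at the function exactly when `a / x_K ^ i` has value
zero, that is, when `a` is in the ideal of the image. -/
theorem gpOfMorphism_point (K : RSubset r E) (hK : χ.image ∈ chart K) :
    χ.image = (gpOfMorphism χ K hK).point := by
  refine ProjPt.ext (Set.ext fun a => ?_)
  have key : ∀ a ∈ (matAlg r E).mon, (gpOfMorphism χ K hK).ev.toRingHom a = 0 ↔
      a ∈ (projImage χ).carrier := by
    intro a ha
    obtain ⟨i, hi⟩ := (matAlg r E).cover a ha
    have h := gpOfMorphism_ev χ K hK ⟨a, hi⟩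
    rw [← value_projSection_eq_zero_iff χ hK ⟨a, hi⟩ (coordPow K i) (coordPow_notMem i)]
    exact ⟨fun h' => h.symm.trans h', fun h' => h.trans h'⟩
  exact ⟨fun h => ⟨(projImage χ).subset h, (key a ((projImage χ).subset h)).2 h⟩,
    fun h => (key a h.1).1 h.2⟩

/-- The image points agree, so values of sections remain. Near the image a section is a fraction `a
/ h`. Both morphisms give it the value `a(Δ) / h(Δ)`; for `χ` this follows from `(a / h)(h / x_K ^
i) = a / x_K ^ i`. -/
theorem gpOfMorphism_charMor (K : RSubset r E) (hK : χ.image ∈ chart K) :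
    (gpOfMorphism χ K hK).charMor = χ := by
  set Δ := gpOfMorphism χ K hK with hΔ
  have hpt : χ.image = Δ.point := gpOfMorphism_point χ K hK
  refine OBSpace.Hom.ext_value hpt.symm fun V hV hV' s hs => ?_
  change Δ.point ∈ V at hV
  obtain ⟨W, hW, ⟨i, a, h⟩, hi⟩ := (projData (matAlg r E)).mem_sections_mon.1 hs _ hV
  obtain ⟨hh, h1⟩ := hi _ hV hW
  refine IsUnitElt.mul_left_cancel (Δ.isUnitElt_ev ((matAlg r E).part_subset _ h.2) hh) ?_
  have h2 : (Δ.charMor.value V hV).toRingHom s = Δ.evLoc.toRingHom (Δ.point.frac a h hh) :=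
    (value_pointMor _ _ _ V hV s).trans (congrArg Δ.evLoc.toRingHom h1)
  refine ((congrArg (Δ.ev.toRingHom h * ·) h2).trans (Δ.evLoc_frac a h hh)).trans ?_
  -- Over this neighbourhood the section equals `a / h` and `x_K` is invertible, so all three
  -- fractions of the identity are sections.
  let V' : Opens (ProjPt (matAlg r E)) := V ⊓ (W ⊓ chart K)
  have hV'' : χ.image ∈ V' := ⟨hV', hpt ▸ hW, hK⟩
  have hn : ∀ p ∈ V', (h : (matAlg r E).plus) ∉ p.carrier := fun p hp => (hi p hp.1 hp.2.1).1
  have h3 : ((projData (matAlg r E)).space.res (inf_le_left : V' ≤ V)).toRingHom s =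
      projSection a h hn :=
    (projData (matAlg r E)).sections_ext fun p hp => (hi p hp.1 hp.2.1).2
  have h4 : (χ.value V hV').toRingHom s = (χ.value V' hV'').toRingHom (projSection a h hn) :=
    (χ.value_res (inf_le_left : V' ≤ V) hV' hV'' s).symm.trans
      (congrArg (χ.value V' hV'').toRingHom h3)
  have h5 : ∀ b : (matAlg r E).part i, Δ.ev.toRingHom b = (χ.value V' hV'').toRingHom
      (projSection b (coordPow K i) fun p hp => coordPow_notMem i p hp.2.2) := fun b =>
    (gpOfMorphism_ev χ K hK b).trans (χ.value_res
      (inf_le_right.trans inf_le_right : V' ≤ chart K) hK hV''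
      (projSection b (coordPow K i) (coordPow_notMem i))).symm
  have h6 := congrArg (χ.value V' hV'').toRingHom (projSection_mul_projSection a h
    (coordPow K i) hn fun p hp => coordPow_notMem i p hp.2.2)
  have h7 := (map_mul (χ.value V' hV'').toRingHom _ _).symm.trans h6
  rw [h5 a, h5 h, h4, mul_comm]
  exact h7.symm

/-- Every morphism `Spec F → Mat(r, E)` is the characteristic morphism of an `F`-matroid. -/
theorem FMatroid.charMor_surjective :
    Function.Surjective (FMatroid.charMor : FMatroid F r E → _) := by
  intro χ
  obtain ⟨K, hK⟩ := exists_mem_chart (projImage χ)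
  exact ⟨⟦gpOfMorphism χ K hK⟧, gpOfMorphism_charMor χ K hK⟩

/-- Once `Δ(K)` is a unit, the characteristic morphism knows the value `Δ(I) / Δ(K)` of `x_I / x_K`
for every `I`. -/
theorem GPFun.equiv_of_charMor_eq {Δ Δ' : GPFun F r E} (h : Δ.charMor = Δ'.charMor) : Δ ≈ Δ' := by
  have hpt : Δ.point = Δ'.point := congrArg (fun ψ => projImage ψ) h
  obtain ⟨K, hK⟩ := Δ.exists_unit
  have hev : ∀ (Δ : GPFun F r E) (I : RSubset r E), Δ.ev.toRingHom (coord I) = Δ.toFun I :=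
    fun Δ I => (Δ.ev_mk _).trans (Δ.polyEval_X I)
  have hk : (coord K : (matAlg r E).plus) ∉ Δ.point.carrier := fun hk =>
    F.isPasture.unit_ne_zero hK ((hev Δ K).symm.trans hk.2)
  have hk' : (coord K : (matAlg r E).plus) ∉ Δ'.point.carrier := hpt ▸ hk
  have hu' := Δ'.isUnitElt_ev ((matAlg r E).part_subset _ (coord K).2) hk'
  rw [hev] at hu'
  obtain ⟨h1, c, hc, hc'⟩ := hu'
  -- The scaling factor is `Δ(K) / Δ'(K)`, with `c` the inverse of `Δ'(K)`.
  refine ⟨Δ.toFun K * c, F.unitGroup.mul_mem hK ⟨hc, _, h1, by rw [mul_comm, hc']⟩, fun I => ?_⟩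
  have h2 := Δ.evLoc_frac (coord I) (coord K) hk
  have h3 := Δ'.evLoc_frac (coord I) (coord K) hk'
  rw [hev, hev] at h2 h3
  rw [← h2, ← h3, pointMor_frac h (coord I) (coord K) hk hk', mul_assoc (Δ.toFun K),
    ← mul_assoc c, mul_comm c, hc', one_mul]

theorem FMatroid.charMor_injective :
    Function.Injective (FMatroid.charMor : FMatroid F r E → _) := by
  rintro ⟨Δ⟩ ⟨Δ'⟩ h
  exact Quotient.sound (GPFun.equiv_of_charMor_eq h)

/-! ### Functoriality -/

variable {F' : Pasture.{v}} (g : Hom F.toOBlpr F'.toOBlpr)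

theorem GPFun.ev_map (Δ : GPFun F r E) : (Δ.map g).ev = Δ.ev.comp g := by
  refine hom_ext_mon ?_
  rintro _ ⟨m, hm, rfl⟩
  change (Δ.map g).polyEval m = g.toRingHom (Δ.polyEval m)
  obtain ⟨i, rfl | ⟨d, s, rfl, rfl⟩⟩ := hm
  · rw [map_zero, map_zero, map_zero]
  · rw [GPFun.polyEval_monomial, GPFun.polyEval_monomial, map_mul, signHom_of, signHom_of,
      Finsupp.prod, Finsupp.prod, map_prod]
    congr 1
    · split_ifs
      · rw [map_one]
      · exact (g.map_eps F.isPasture.pasteurized F'.isPasture.pasteurized).symm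
    · exact Finset.prod_congr rfl fun I _ => (map_pow _ _ _).symm

/-- The points agree because `g` sends no nonzero element of `F^•` to `0`. On fractions both sides
give `g(a(Δ)) / g(k(Δ))`. -/
theorem GPFun.charMor_map (Δ : GPFun F r E) :
    (Δ.map g).charMor = (Spec.map g).comp Δ.charMor := by
  have hev : ∀ a, (Δ.map g).ev.toRingHom a = g.toRingHom (Δ.ev.toRingHom a) := fun a => by
    rw [Δ.ev_map g]
    rfl
  refine Eq.trans ?_ (specMap_comp_pointMor Δ.point Δ.evLoc Δ.evLoc_nonunit g
    (Hom.comp_nonunit Δ.evLoc_nonunit g)).symm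
  have hpt : (Δ.map g).point = Δ.point := by
    ext a
    refine and_congr_right fun ha => ?_
    rw [hev]
    exact g.map_eq_zero_iff (Δ.ev.map_mon ha)
  refine pointMor_congr hpt _ _ fun i a k hk hk' => ?_
  refine IsUnitElt.mul_left_cancel
    ((Δ.map g).isUnitElt_ev ((matAlg r E).part_subset _ k.2) hk) ?_
  rw [(Δ.map g).evLoc_frac a k hk, hev, hev, ← Δ.evLoc_frac a k hk', map_mul]
  rfl

theorem FMatroid.charMor_push (N : FMatroid F r E) :
    (N.push g).charMor = (Spec.map g).comp N.charMor := by
  induction N using Quotient.inductionOn with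
  | h Δ => exact Δ.charMor_map g

theorem terminalMap_unique (t : Hom F.toOBlpr krasner) : t = terminalMap F :=
  (Classical.choice (unique_terminal F)).uniq t

/-- Terminality of `𝕂` gives `t_{F'} ∘ g = t_F`. -/
theorem FMatroid.underlying_push (N : FMatroid F r E) :
    (N.push g).underlying = N.underlying := by
  induction N using Quotient.inductionOn with
  | h Δ =>
    refine congrArg (Quotient.mk _) (GPFun.ext (funext fun I => ?_))
    exact congrArg (fun t : Hom F.toOBlpr krasner => t.toRingHom (Δ.toFun I))
      (terminalMap_unique (g.comp (terminalMap F')))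

/-- The composite `χ_N ∘ t_F^*` is the characteristic morphism of the underlying matroid, and
characteristic morphisms over `𝕂` determine their matroid. -/
theorem FMatroid.charMor_mem_realizationSpace_iff {M : FMatroid Krasner r E}
    {N : FMatroid F r E} : N.charMor ∈ M.realizationSpace F ↔ N.underlying = M := by
  change (Spec.map (terminalMap F)).comp N.charMor = M.charMor ↔ _
  rw [← N.charMor_push]
  exact FMatroid.charMor_injective.eq_iff

/-! ### The universal pasture -/

variable (M : FMatroid Krasner r E)

/-- The morphism from the local blueprint at the support of `M` to the universal pasture. -/
def FMatroid.toUniversal : Hom M.support.loc M.universalPasture :=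
  M.support.toResidueField.comp M.support.residueField.toPasteurization

theorem FMatroid.toUniversal_comp_nonunit {D : OBlpr.{v}} (f : Hom M.universalPasture D)
    (z : M.support.loc.plus) (hz : z ∈ M.support.loc.mon) (hu : ¬ M.support.loc.IsUnitElt z) :
    (M.toUniversal.comp f).toRingHom z = 0 :=
  Hom.comp_nonunit (Hom.comp_nonunit M.support.toResidueField_nonunit _) f z hz hu

/-- Turns the map of the theorem into precomposition with `toUniversal`, so that its bijectivity
becomes a question about universal properties. -/
theorem FMatroid.specMap_comp_inclusion {D : OBlpr.{v}} (f : Hom M.universalPasture D) :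
    (Spec.map f).comp M.inclusion =
      pointMor M.support (M.toUniversal.comp f) (M.toUniversal_comp_nonunit f) := by
  have h : M.inclusion = pointMor M.support M.toUniversal
      (Hom.comp_nonunit M.support.toResidueField_nonunit _) :=
    specMap_comp_pointMor _ _ _ _ _
  rw [h]
  exact specMap_comp_pointMor _ _ _ f (M.toUniversal_comp_nonunit f)

/-- The uniqueness halves of the universal properties of pasteurization and residue field; the
existence halves give the next lemma. -/
theorem FMatroid.toUniversal_injective {f f' : Hom M.universalPasture F.toOBlpr}
    (h : M.toUniversal.comp f = M.toUniversal.comp f') : f = f' :=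
  OBlpr.pasteurization_hom_ext F.isPasture.pasteurized (M.support.residueField_hom_ext h)

theorem FMatroid.exists_toUniversal_comp {φ : Hom M.support.loc F.toOBlpr}
    (hφ : ∀ z ∈ M.support.loc.mon, ¬ M.support.loc.IsUnitElt z → φ.toRingHom z = 0) :
    ∃ f : Hom M.universalPasture F.toOBlpr, M.toUniversal.comp f = φ := by
  obtain ⟨k, rfl⟩ := M.support.exists_residueField_lift φ hφ
  obtain ⟨f, rfl⟩ := OBlpr.exists_pasteurization_lift k
  exact ⟨f, rfl⟩

/-- By `hom_krasner_unique`, `χ_M` is determined by its image point. Hence the condition `χ ∘ t_F^*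
= χ_M` holds for every morphism `pointMor` at `x_M`. -/
theorem FMatroid.charMor_eq_pointMor (φ : Hom M.support.loc Krasner.toOBlpr)
    (hφ : ∀ z ∈ M.support.loc.mon, ¬ M.support.loc.IsUnitElt z → φ.toRingHom z = 0) :
    M.charMor = pointMor M.support φ hφ := by
  induction M using Quotient.inductionOn with
  | h Δ => exact hom_ext_pointMor Δ.evLoc_nonunit hφ (hom_krasner_unique Δ.evLoc_nonunit hφ)

/-- Composition with `t_F^*` keeps the image point, so a realization has image `x_M`. Being a
characteristic morphism, it is a `pointMor` by construction. -/
theorem FMatroid.exists_eq_pointMor {χ : (Spec F.toOBlpr).Hom (Mat r E)}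
    (hχ : χ ∈ M.realizationSpace F) : ∃ (φ : Hom M.support.loc F.toOBlpr)
      (hφ : ∀ z ∈ M.support.loc.mon, ¬ M.support.loc.IsUnitElt z → φ.toRingHom z = 0),
      χ = pointMor M.support φ hφ := by
  have hpt : projImage χ = M.support := by
    refine Eq.trans ?_ (congrArg (fun ψ => projImage ψ) hχ)
    exact (χ.base_eq_image _).symm
  obtain ⟨⟨Δ⟩, rfl⟩ := FMatroid.charMor_surjective χ
  rw [← hpt]
  exact ⟨Δ.evLoc, Δ.evLoc_nonunit, rfl⟩

theorem FMatroid.bijOn_universalPasture :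
    Set.BijOn (fun f : Hom M.universalPasture F.toOBlpr => (Spec.map f).comp M.inclusion)
      Set.univ (M.realizationSpace F) := by
  refine ⟨fun f _ => ?_, fun f _ f' _ h => ?_, fun χ hχ => ?_⟩
  · change (Spec.map (terminalMap F)).comp ((Spec.map f).comp M.inclusion) = M.charMor
    rw [M.specMap_comp_inclusion]
    exact (specMap_comp_pointMor _ _ _ _
      (Hom.comp_nonunit (M.toUniversal_comp_nonunit f) _)).trans (M.charMor_eq_pointMor _ _).symm
  -- Injectivity: `pointMor` at a fixed point determines its map `φ`, and `φ` determines `f`.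
  · beta_reduce at h
    rw [M.specMap_comp_inclusion, M.specMap_comp_inclusion] at h
    exact M.toUniversal_injective (pointMor_injective h)
  -- Surjectivity: a realization is given by some `φ` killing non-units, which factors through the
  -- residue field and its pasteurization.
  · obtain ⟨φ, hφ, rfl⟩ := M.exists_eq_pointMor hχ
    obtain ⟨f, rfl⟩ := M.exists_toUniversal_comp hφ
    exact ⟨f, trivial, M.specMap_comp_inclusion f⟩

/-- Via characteristic morphisms this is the invariance of the underlying matroid under
push-forward. -/
theorem FMatroid.mapsTo_realizationSpace :
    Set.MapsTo (fun χ => (Spec.map g).comp χ) (M.realizationSpace F) (M.realizationSpace F') := by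
  intro χ hχ
  obtain ⟨N, rfl⟩ := FMatroid.charMor_surjective χ
  beta_reduce
  rw [← N.charMor_push, FMatroid.charMor_mem_realizationSpace_iff, N.underlying_push]
  exact FMatroid.charMor_mem_realizationSpace_iff.1 hχ

theorem FMatroid.specMap_comp_comp_inclusion (f : Hom M.universalPasture F.toOBlpr) :
    (Spec.map (f.comp g)).comp M.inclusion =
      (Spec.map g).comp ((Spec.map f).comp M.inclusion) := by
  rw [M.specMap_comp_inclusion, M.specMap_comp_inclusion]
  exact (specMap_comp_pointMor _ _ _ _
    (Hom.comp_nonunit (M.toUniversal_comp_nonunit f) g)).symm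

theorem FMatroid.bijOn_charMor :
    Set.BijOn (fun N : FMatroid F r E => N.charMor) {N | N.underlying = M}
      (M.realizationSpace F) := by
  refine ⟨fun N hN => FMatroid.charMor_mem_realizationSpace_iff.2 hN,
    FMatroid.charMor_injective.injOn, fun χ hχ => ?_⟩
  obtain ⟨N, rfl⟩ := FMatroid.charMor_surjective χ
  exact ⟨N, FMatroid.charMor_mem_realizationSpace_iff.1 hχ, rfl⟩

end MatMorphism

end OB

end

/-! ### The realization space as morphisms from the universal pasture and as matroids -/

theorem mainTheorem4 {E : Type u} [Finite E] [LinearOrder E] (r : ℕ)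
    (M : OB.FMatroid OB.Krasner r E) (F : OB.Pasture.{v}) :
    -- the map `f ↦ ι_M ∘ f^*` is a bijection from `Hom(k_M, F)` to the realization space `𝒳_M(F)`
    Set.BijOn
      (fun f : OB.Hom M.universalPasture F.toOBlpr => (OB.Spec.map f).comp M.inclusion)
      Set.univ (M.realizationSpace F) ∧
    -- it is functorial in `F`
    (∀ (F' : OB.Pasture.{w}) (g : OB.Hom F.toOBlpr F'.toOBlpr),
      Set.MapsTo (fun χ => (OB.Spec.map g).comp χ) (M.realizationSpace F)
        (M.realizationSpace F') ∧
      ∀ f : OB.Hom M.universalPasture F.toOBlpr,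
        (OB.Spec.map (f.comp g)).comp M.inclusion =
          (OB.Spec.map g).comp ((OB.Spec.map f).comp M.inclusion)) ∧
    -- `N ↦ χ_N` identifies the strong `F`-matroids with underlying matroid `M` with `𝒳_M(F)`
    Set.BijOn (fun N : OB.FMatroid F r E => N.charMor) {N | N.underlying = M}
      (M.realizationSpace F) ∧
    -- and this identification is functorial in `F`
    (∀ (F' : OB.Pasture.{w}) (g : OB.Hom F.toOBlpr F'.toOBlpr) (N : OB.FMatroid F r E),
      N.underlying = M → (N.push g).underlying = M ∧
        (N.push g).charMor = (OB.Spec.map g).comp N.charMor) :=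
  ⟨M.bijOn_universalPasture,
    fun _ g => ⟨M.mapsTo_realizationSpace g, fun f => M.specMap_comp_comp_inclusion g f⟩,
    M.bijOn_charMor,
    fun _ g N hN => ⟨(N.underlying_push g).trans hN, N.charMor_push g⟩⟩
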